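/- Let $4\le p<6$ and $k\ge 0$. For $\theta>0$ and $\mu\in\mathbb R$ consider on $\mathbb R$ the equation $$-u''+\mu u-k\,(u^2)''\,u-\theta|u|^{p-2}u=0. \qquad (E_{\mu,\theta})$$ A real-valued $u\in H^1(\mathbb R)$ is called a (weak) solution of $(E_{\mu,\theta})$ if $$\int_{\mathbb R}u'v'+\mu\int_{\mathbb R}uv+k\int_{\mathbb R}(u^2)'(uv)'-\theta\int_{\mathbb R}|u|^{p-2}uv=0\qquad\text{for all } v\in H^1(\mathbb R),$$ and a positive solution if moreover its continuous representative satisfies $u(x)>0$ for all $x\in\mathbb R$. For $\lambda>0$ put $$\mathcal M_\lambda=\Big\{w\in H^1(\mathbb R;\mathbb C):\ \tfrac12\int_{\mathbb R}|w|^2=\lambda\Big\},\qquad I_\theta(w)=\int_{\mathbb R}\Big[\tfrac12|w'|^2+\tfrac k4\big|(|w|^2)'\big|^2-\tfrac\theta p|w|^p\Big].$$ 1. For every $\lambda>0$ and every $\theta>0$ there are $\gamma<0$ and a positive solution $u\in H^1(\mathbb R)$ of $(E_{\mu,\theta})$ with $\mu=-\gamma$ such that $u\in\mathcal M_\lambda$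 and $I_\theta(u)=\min_{\mathcal M_\lambda}I_\theta$; that is, $u$ is a minimizer of $I_\theta$ on $\mathcal M_\lambda$ with Lagrange multiplier $\gamma$. 2. There is $\gamma<0$ such that, for every $\theta>0$, the equation $(E_{\mu,\theta})$ with $\mu=-\gamma$ has a positive solution $u\in H^1(\mathbb R)$. -/

import Mathlib

open MeasureTheory
open scoped ContDiff

noncomputable section

/-- `g` is a weak (distributional) derivative of `f` on the real line:
both are locally integrable and `∫ f φ' = - ∫ g φ` for every `φ ∈ C_c^∞(ℝ)`. -/
def HasWeakDeriv {E : Type*} [NormedAddCommGroup E] [NormedSpace ℝ E] (f g : ℝ → E) : Prop :=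
  LocallyIntegrable f volume ∧ LocallyIntegrable g volume ∧
    ∀ φ : ℝ → ℝ, ContDiff ℝ ∞ φ → HasCompactSupport φ →
      ∫ x, deriv φ x • f x = - ∫ x, φ x • g x

open Classical in
/-- The weak derivative of `f` (unique up to a null set, see `HasWeakDeriv.weakDeriv_ae_eq`);
the value is `0` if `f` has no weak derivative. -/
def weakDeriv {E : Type*} [NormedAddCommGroup E] [NormedSpace ℝ E] (f : ℝ → E) : ℝ → E :=
  if h : ∃ g, HasWeakDeriv f g then h.choose else 0

theorem HasWeakDeriv.weakDeriv_ae_eq {E : Type*} [NormedAddCommGroup E] [NormedSpace ℝ E]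
    [CompleteSpace E] {f g : ℝ → E} (h : HasWeakDeriv f g) : weakDeriv f =ᵐ[volume] g := by
  have hex : ∃ g, HasWeakDeriv f g := ⟨g, h⟩
  have hs : HasWeakDeriv f (weakDeriv f) := by
    rw [weakDeriv, dif_pos hex]
    exact hex.choose_spec
  refine ae_eq_of_integral_contDiff_smul_eq hs.2.1 h.2.1 fun φ hφ hc => ?_
  have h1 := hs.2.2 φ hφ hc
  have h2 := h.2.2 φ hφ hc
  rw [h1] at h2
  exact neg_injective h2

/-- `f ∈ H¹(ℝ) = W^{1,2}(ℝ)`: `f ∈ L²` and `f` has a weak derivative in `L²`. -/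
def MemH1 {E : Type*} [NormedAddCommGroup E] [NormedSpace ℝ E] (f : ℝ → E) : Prop :=
  MemLp f 2 volume ∧ ∃ g, HasWeakDeriv f g ∧ MemLp g 2 volume

/-- The energy `I(u) = ∫ (1/2)|u'|² + (k/4)|(|u|²)'|² - (θ/p)|u|^p`. -/
def energy (k θ p : ℝ) (u : ℝ → ℂ) : ℝ :=
  ∫ x, (1 / 2 * ‖weakDeriv u x‖ ^ 2
    + k / 4 * (weakDeriv (fun y => ‖u y‖ ^ 2) x) ^ 2
    - θ / p * ‖u x‖ ^ p)

/-- The constraint set `{u ∈ H¹(ℝ; ℂ) : (1/2) ∫ |u|² = lam}`. -/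
def massSphere (lam : ℝ) : Set (ℝ → ℂ) :=
  {u | MemH1 u ∧ 1 / 2 * ∫ x, ‖u x‖ ^ 2 = lam}

/-- A real-valued `u ∈ H¹(ℝ)` is a weak solution of
`-u'' + μ u - k (u²)'' u - θ |u|^{p-2} u = 0`, tested against all `v ∈ H¹(ℝ)`. -/
def IsWeakSolution (k θ μ p : ℝ) (u : ℝ → ℝ) : Prop :=
  MemH1 u ∧ ∀ v : ℝ → ℝ, MemH1 v →
    (∫ x, weakDeriv u x * weakDeriv v x) + μ * (∫ x, u x * v x)
      + k * (∫ x, weakDeriv (fun y => u y ^ 2) x * weakDeriv (fun y => u y * v y) x)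
      - θ * (∫ x, |u x| ^ (p - 2) * u x * v x) = 0

/-- A positive solution: a weak solution whose continuous representative is positive everywhere. -/
def IsPositiveSolution (k θ μ p : ℝ) (u : ℝ → ℝ) : Prop :=
  Continuous u ∧ (∀ x, 0 < u x) ∧ IsWeakSolution k θ μ p u

end

open Filter Topology Set

/-!
Only the density `ρ = |w|²`, its derivative and the kinetic density `N = |w'|²` matter for the
energy `E`, and they satisfy `ρ'² ≤ 4ρN`. Write `ν(s) = (2θ/p) s^((p-2)/2)`, so that the potential
energy is `-∫ ν(ρ)ρ/2`, and let `m` be the maximum of `ρ`. Young's inequality gives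
`√((1 + 2kρ)(ν(m) - ν(ρ))) |ρ'| ≤ N + (k/2)ρ'² + ρ(ν(m) - ν(ρ))`. Since `ρ` rises from `0` to `m`
and falls back to `0`, integrating this bounds `E + ν(m)∫ρ/2` from below by the action
`A(m) = ∫₀ᵐ √((1 + 2ks)(ν(m) - ν(s))) ds`. Equality holds for the soliton of maximal density `m`,
which solves `(1 + 2ku²)u'² = u²(ν(m) - ν(u²))`, and hence the equation with `μ = ν(m)`; it is an
explicit semilinear soliton after a change of variable.

Thus `E ≥ A(m) - ν(m)λ` on the mass sphere, and for `2 < p < 6` the right-hand side has a minimiser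
`m > 0`. Its soliton has mass `λ`: the amplitude rescalings `aρ` satisfy
`E(aρ) + ν(am)(a∫ρ/2 - λ) ≥ A(am) - ν(am)λ ≥ A(m) - ν(m)λ` with equality at `a = 1`, so the
left-hand side is stationary there, which with the Nehari identity forces `∫ρ/2 = λ`.
-/

section LocallyAbsolutelyContinuous

/-- `F` is locally absolutely continuous on the line, with almost everywhere derivative `f`. This is
the pointwise description of a continuous function `F` with weak derivative `f`. -/
structure LocAC (F f : ℝ → ℝ) : Prop where
  ac : ∀ a b, AbsolutelyContinuousOnInterval F a b
  ae_hasDerivAt : ∀ᵐ x, HasDerivAt F (f x) x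

theorem absolutelyContinuousOnInterval_comp_of_lipschitzOnWith {X Y : Type*}
    [PseudoMetricSpace X] [PseudoMetricSpace Y] {F : ℝ → X} {G : X → Y} {K : NNReal} {s : Set X}
    {a b : ℝ} (hG : LipschitzOnWith K G s) (hF : AbsolutelyContinuousOnInterval F a b)
    (hs : MapsTo F (uIcc a b) s) :
    AbsolutelyContinuousOnInterval (fun x => G (F x)) a b := by
  have hK := Tendsto.const_mul (K : ℝ) hF
  rw [mul_zero] at hK
  refine squeeze_zero'
    (Eventually.of_forall fun E => Finset.sum_nonneg fun _ _ => dist_nonneg) ?_ hK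
  filter_upwards [mem_inf_of_right (mem_principal_self _)] with E hE
  rw [Finset.mul_sum]
  exact Finset.sum_le_sum fun i hi =>
    hG.dist_le_mul _ (hs (hE.1 i hi).1) _ (hs (hE.1 i hi).2)

namespace LocAC

variable {F f G g : ℝ → ℝ}

theorem continuous (h : LocAC F f) : Continuous F := by
  refine continuous_iff_continuousAt.2 fun x => ?_
  refine (h.ac (x - 1) (x + 1)).continuousOn.continuousAt ?_
  rw [uIcc_of_le (by linarith)]
  exact Icc_mem_nhds (by linarith) (by linarith)

theorem deriv_ae_eq (h : LocAC F f) : deriv F =ᵐ[volume] f :=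
  h.ae_hasDerivAt.mono fun _ hx => hx.deriv

theorem intervalIntegrable (h : LocAC F f) (a b : ℝ) : IntervalIntegrable f volume a b :=
  (h.ac a b).intervalIntegrable_deriv.congr_ae (ae_restrict_of_ae h.deriv_ae_eq)

theorem locallyIntegrable (h : LocAC F f) : LocallyIntegrable f volume := fun x =>
  ⟨Ioc (x - 1) (x + 1), Ioc_mem_nhds (by linarith) (by linarith),
    (intervalIntegrable_iff_integrableOn_Ioc_of_le (by linarith)).1 (h.intervalIntegrable _ _)⟩

theorem integral_eq_sub (h : LocAC F f) (a b : ℝ) : ∫ x in a..b, f x = F b - F a := by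
  rw [← (h.ac a b).integral_deriv_eq_sub]
  exact intervalIntegral.integral_congr_ae (h.deriv_ae_eq.mono fun x hx _ => hx.symm)

theorem of_integral (hf : LocallyIntegrable f volume) (C : ℝ) :
    LocAC (fun x => C + ∫ t in (0 : ℝ)..x, f t) f := by
  refine ⟨fun a b => ?_, ?_⟩
  · have hconst : AbsolutelyContinuousOnInterval (fun _ : ℝ => C) a b :=
      contDiff_const.contDiffOn.absolutelyContinuousOnInterval
    have hint : IntervalIntegrable f volume (a ⊓ b ⊓ 0) (a ⊔ b ⊔ 0) :=
      intervalIntegrable_iff.2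
        ((hf.integrableOn_isCompact isCompact_uIcc).mono_set uIoc_subset_uIcc)
    have hle : a ⊓ b ⊓ 0 ≤ a ⊔ b ⊔ 0 := inf_le_right.trans le_sup_right
    refine hconst.add ((hint.absolutelyContinuousOnInterval_intervalIntegral
      (c := 0) ?_).mono ?_)
    · rw [uIcc_of_le hle]
      exact ⟨inf_le_right, le_sup_right⟩
    · rw [uIcc_of_le hle]
      exact Icc_subset_Icc inf_le_left le_sup_left
  · filter_upwards [_root_.LocallyIntegrable.ae_hasDerivAt_integral hf] with x hx
    exact (hx 0).const_add C

theorem of_hasDerivAt (h : ∀ x, HasDerivAt F (f x) x) (hf : Continuous f) : LocAC F f := by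
  have hd : deriv F = f := funext fun x => (h x).deriv
  have hF : ContDiff ℝ 1 F :=
    contDiff_one_iff_deriv.2 ⟨fun x => (h x).differentiableAt, hd ▸ hf⟩
  exact ⟨fun a b => hF.contDiffOn.absolutelyContinuousOnInterval, ae_of_all _ h⟩

theorem add (hF : LocAC F f) (hG : LocAC G g) :
    LocAC (fun x => F x + G x) (fun x => f x + g x) :=
  ⟨fun a b => (hF.ac a b).add (hG.ac a b), by
    filter_upwards [hF.ae_hasDerivAt, hG.ae_hasDerivAt] with x h1 h2 using h1.add h2⟩

theorem mul (hF : LocAC F f) (hG : LocAC G g) :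
    LocAC (fun x => F x * G x) (fun x => f x * G x + F x * g x) :=
  ⟨fun a b => (hF.ac a b).mul (hG.ac a b), by
    filter_upwards [hF.ae_hasDerivAt, hG.ae_hasDerivAt] with x h1 h2 using h1.mul h2⟩

theorem const_mul (c : ℝ) (hF : LocAC F f) : LocAC (fun x => c * F x) (fun x => c * f x) :=
  ⟨fun a b => (hF.ac a b).const_mul c, hF.ae_hasDerivAt.mono fun _ hx => hx.const_mul c⟩

theorem sq (hF : LocAC F f) : LocAC (fun x => F x ^ 2) (fun x => 2 * F x * f x) := by
  convert! hF.mul hF using 2 <;> ring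

theorem comp (hF : LocAC F f) (hG : ∀ s, HasDerivAt G (g s) s) (hg : Continuous g) :
    LocAC (fun x => G (F x)) (fun x => g (F x) * f x) := by
  refine ⟨fun a b => ?_, hF.ae_hasDerivAt.mono fun x hx => (hG (F x)).comp x hx⟩
  obtain ⟨B, hB⟩ := (hF.ac a b).exists_bound
  have hd : deriv G = g := funext fun x => (hG x).deriv
  have hC : ContDiff ℝ 1 G :=
    contDiff_one_iff_deriv.2 ⟨fun x => (hG x).differentiableAt, hd ▸ hg⟩
  obtain ⟨K, hK⟩ := (hC.contDiffOn (s := Icc (-B) B)).exists_lipschitzOnWith one_ne_zero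
    (convex_Icc _ _) isCompact_Icc
  exact absolutelyContinuousOnInterval_comp_of_lipschitzOnWith hK (hF.ac a b)
    fun x hx => abs_le.1 (hB x hx)

theorem tendsto_atTop_zero (h : LocAC F f) (hF : Integrable F) (hf : Integrable f) :
    Tendsto F atTop (𝓝 0) := by
  have hlim : Tendsto F atTop (𝓝 (F 0 + ∫ x in Ioi 0, f x)) := by
    refine ((intervalIntegral_tendsto_integral_Ioi 0 hf.integrableOn tendsto_id).const_add
      (F 0)).congr fun x => ?_
    rw [id, h.integral_eq_sub, add_sub_cancel]
  have hzero := IntegrableAtFilter.eq_zero_of_tendsto (hF.integrableAtFilter atTop)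
    (fun s hs => by
      obtain ⟨b, hb⟩ := mem_atTop_sets.1 hs
      exact measure_mono_top hb Real.volume_Ici) hlim
  rwa [hzero] at hlim

theorem tendsto_atBot_zero (h : LocAC F f) (hF : Integrable F) (hf : Integrable f) :
    Tendsto F atBot (𝓝 0) := by
  have hlim : Tendsto F atBot (𝓝 (F 0 - ∫ x in Iic 0, f x)) := by
    refine ((intervalIntegral_tendsto_integral_Iic 0 hf.integrableOn tendsto_id).const_sub
      (F 0)).congr fun x => ?_
    rw [id, h.integral_eq_sub, sub_sub_cancel]
  have hzero := IntegrableAtFilter.eq_zero_of_tendsto (hF.integrableAtFilter atBot)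
    (fun s hs => by
      obtain ⟨b, hb⟩ := mem_atBot_sets.1 hs
      exact measure_mono_top hb Real.volume_Iic) hlim
  rwa [hzero] at hlim

theorem integral_Iic_of_tendsto (h : LocAC F f) (hf : Integrable f) {L : ℝ}
    (hL : Tendsto F atBot (𝓝 L)) (a : ℝ) : ∫ x in Iic a, f x = F a - L :=
  tendsto_nhds_unique (intervalIntegral_tendsto_integral_Iic a hf.integrableOn tendsto_id)
    ((hL.const_sub (F a)).congr fun x => (h.integral_eq_sub x a).symm)

theorem integral_Ioi_of_tendsto (h : LocAC F f) (hf : Integrable f) {L : ℝ}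
    (hL : Tendsto F atTop (𝓝 L)) (a : ℝ) : ∫ x in Ioi a, f x = L - F a :=
  tendsto_nhds_unique (intervalIntegral_tendsto_integral_Ioi a hf.integrableOn tendsto_id)
    ((hL.sub_const (F a)).congr fun x => (h.integral_eq_sub a x).symm)

theorem abs_le_integral_abs (h : LocAC F f) (hF : Integrable F) (hf : Integrable f) (x : ℝ) :
    |F x| ≤ ∫ t, |f t| := by
  rw [← sub_zero (F x), ← h.integral_Iic_of_tendsto hf (h.tendsto_atBot_zero hF hf) x]
  exact (norm_integral_le_integral_norm _).trans
    (setIntegral_le_integral hf.norm (ae_of_all _ fun _ => norm_nonneg _))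

theorem integral_eq_zero (h : LocAC F f) (hF : Integrable F) (hf : Integrable f) :
    ∫ x, f x = 0 := by
  rw [← intervalIntegral.integral_Iic_add_Ioi (b := 0) hf.integrableOn hf.integrableOn,
    h.integral_Iic_of_tendsto hf (h.tendsto_atBot_zero hF hf),
    h.integral_Ioi_of_tendsto hf (h.tendsto_atTop_zero hF hf)]
  ring

theorem integral_mul_add_mul_eq_zero (hF : LocAC F f) (hG : LocAC G g)
    (mF : MemLp F 2) (mf : MemLp f 2) (mG : MemLp G 2) (mg : MemLp g 2) :
    ∫ x, (f x * G x + F x * g x) = 0 :=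
  (hF.mul hG).integral_eq_zero (mF.integrable_mul mG)
    ((mf.integrable_mul mG).add (mF.integrable_mul mg))

theorem hasWeakDeriv (h : LocAC F f) : HasWeakDeriv F f := by
  refine ⟨h.continuous.locallyIntegrable, h.locallyIntegrable, fun φ hφ hc => ?_⟩
  have hφ' : Continuous (deriv φ) := hφ.continuous_deriv (by simp)
  have hφAC : LocAC φ (deriv φ) :=
    of_hasDerivAt (fun x => (hφ.differentiable (by simp) x).hasDerivAt) hφ'
  have i1 : Integrable (fun x => deriv φ x * F x) :=
    (hφ'.mul h.continuous).integrable_of_hasCompactSupport hc.deriv.mul_right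
  have i2 : Integrable (fun x => φ x * f x) :=
    h.locallyIntegrable.integrable_smul_left_of_hasCompactSupport hφ.continuous hc
  have i3 : Integrable (fun x => φ x * F x) :=
    (hφ.continuous.mul h.continuous).integrable_of_hasCompactSupport hc.mul_right
  have hparts := (hφAC.mul h).integral_eq_zero i3 (i1.add i2)
  rw [integral_add i1 i2] at hparts
  exact eq_neg_of_add_eq_zero_left hparts

end LocAC

end LocallyAbsolutelyContinuous

section WeakDerivative

variable {E : Type*} [NormedAddCommGroup E] [NormedSpace ℝ E] {f g f' g' : ℝ → E}

theorem HasWeakDeriv.congr (h : HasWeakDeriv f g) (hf : f =ᵐ[volume] f') (hg : g =ᵐ[volume] g') :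
    HasWeakDeriv f' g' := by
  refine ⟨h.1.congr hf, h.2.1.congr hg, fun φ hφ hc => ?_⟩
  have hf' : ∫ x, deriv φ x • f x = ∫ x, deriv φ x • f' x :=
    integral_congr_ae (hf.mono fun x hx => by simp only [hx])
  have hg' : ∫ x, φ x • g x = ∫ x, φ x • g' x :=
    integral_congr_ae (hg.mono fun x hx => by simp only [hx])
  rw [← hf', ← hg', h.2.2 φ hφ hc]

theorem HasWeakDeriv.sub (h : HasWeakDeriv f g) (h' : HasWeakDeriv f' g') :
    HasWeakDeriv (f - f') (g - g') := by
  refine ⟨h.1.sub h'.1, h.2.1.sub h'.2.1, fun φ hφ hc => ?_⟩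
  have hφ' : Continuous (deriv φ) := hφ.continuous_deriv (by simp)
  simp only [Pi.sub_apply, smul_sub]
  rw [integral_sub (h.1.integrable_smul_left_of_hasCompactSupport hφ' hc.deriv)
      (h'.1.integrable_smul_left_of_hasCompactSupport hφ' hc.deriv),
    integral_sub (h.2.1.integrable_smul_left_of_hasCompactSupport hφ.continuous hc)
      (h'.2.1.integrable_smul_left_of_hasCompactSupport hφ.continuous hc),
    h.2.2 φ hφ hc, h'.2.2 φ hφ hc]
  abel

theorem HasWeakDeriv.clm_comp [CompleteSpace E] {F : Type*} [NormedAddCommGroup F]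
    [NormedSpace ℝ F] [CompleteSpace F] (h : HasWeakDeriv f g) (L : E →L[ℝ] F) :
    HasWeakDeriv (fun x => L (f x)) (fun x => L (g x)) := by
  refine ⟨fun x => ?_, fun x => ?_, fun φ hφ hc => ?_⟩
  · obtain ⟨s, hs, hi⟩ := h.1 x
    exact ⟨s, hs, L.integrable_comp hi⟩
  · obtain ⟨s, hs, hi⟩ := h.2.1 x
    exact ⟨s, hs, L.integrable_comp hi⟩
  · have hφ' : Continuous (deriv φ) := hφ.continuous_deriv (by simp)
    have i1 := h.1.integrable_smul_left_of_hasCompactSupport hφ' hc.deriv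
    have i2 := h.2.1.integrable_smul_left_of_hasCompactSupport hφ.continuous hc
    simp_rw [← map_smul]
    rw [L.integral_comp_comm i1, L.integral_comp_comm i2, h.2.2 φ hφ hc, map_neg]

theorem hasDerivAt_integral_Iic {φ : ℝ → ℝ} (hφ : Continuous φ) (hint : Integrable φ) (x : ℝ) :
    HasDerivAt (fun y => ∫ t in Iic y, φ t) (φ x) x := by
  have hsplit : (fun y => ∫ t in Iic y, φ t)
      = fun y => (∫ t in Iic 0, φ t) + ∫ t in (0 : ℝ)..y, φ t := by
    funext y
    rw [← intervalIntegral.integral_Iic_sub_Iic hint.integrableOn hint.integrableOn,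
      add_sub_cancel]
  rw [hsplit]
  exact (hφ.integral_hasStrictDerivAt 0 x).hasDerivAt.const_add _

theorem hasCompactSupport_integral_Iic {φ : ℝ → ℝ} (hc : HasCompactSupport φ)
    (h0 : ∫ x, φ x = 0) : HasCompactSupport fun x => ∫ t in Iic x, φ t := by
  obtain ⟨a, ha⟩ := hc.isCompact.bddBelow
  obtain ⟨b, hb⟩ := hc.isCompact.bddAbove
  refine HasCompactSupport.intro (isCompact_Icc (a := a) (b := b)) fun x hx => ?_
  rcases lt_or_ge x a with hxa | hxa
  · refine setIntegral_eq_zero_of_forall_eq_zero fun t ht => ?_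
    exact image_eq_zero_of_notMem_tsupport fun hmem =>
      ((ha hmem).trans (mem_Iic.1 ht)).not_gt hxa
  · have hbx : b < x := not_le.1 fun h => hx ⟨hxa, h⟩
    rw [setIntegral_eq_integral_of_forall_compl_eq_zero fun t ht => ?_, h0]
    exact image_eq_zero_of_notMem_tsupport fun hmem => ht ((hb hmem).trans hbx.le)

theorem exists_contDiff_primitive_hasCompactSupport {φ : ℝ → ℝ} (hφ : ContDiff ℝ ∞ φ)
    (hc : HasCompactSupport φ) (h0 : ∫ x, φ x = 0) :
    ∃ Φ : ℝ → ℝ, ContDiff ℝ ∞ Φ ∧ HasCompactSupport Φ ∧ deriv Φ = φ := by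
  have hd := hasDerivAt_integral_Iic hφ.continuous
    (hφ.continuous.integrable_of_hasCompactSupport hc)
  have hd' : deriv (fun x => ∫ t in Iic x, φ t) = φ := funext fun x => (hd x).deriv
  exact ⟨_, contDiff_infty_iff_deriv.2 ⟨fun x => (hd x).differentiableAt, by rwa [hd']⟩,
    hasCompactSupport_integral_Iic hc h0, hd'⟩

theorem HasWeakDeriv.integral_smul_eq_zero (h : HasWeakDeriv f 0) {φ : ℝ → ℝ}
    (hφ : ContDiff ℝ ∞ φ) (hc : HasCompactSupport φ) (h0 : ∫ x, φ x = 0) :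
    ∫ x, φ x • f x = 0 := by
  obtain ⟨Φ, hΦ, hΦc, rfl⟩ := exists_contDiff_primitive_hasCompactSupport hφ hc h0
  simpa only [Pi.zero_apply, smul_zero, integral_zero, neg_zero] using h.2.2 Φ hΦ hΦc

theorem HasWeakDeriv.ae_eq_const [CompleteSpace E] (h : HasWeakDeriv f 0) :
    ∃ C : E, f =ᵐ[volume] fun _ => C := by
  let b : ContDiffBump (0 : ℝ) := default
  let η : ℝ → ℝ := b.normed volume
  have hη : ContDiff ℝ ∞ η := b.contDiff_normed
  have hηc : HasCompactSupport η := b.hasCompactSupport_normed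
  have hηi : Integrable η := hη.continuous.integrable_of_hasCompactSupport hηc
  refine ⟨∫ x, η x • f x, ae_eq_of_integral_contDiff_smul_eq h.1
    continuous_const.locallyIntegrable fun φ hφ hc => ?_⟩
  have hφi : Integrable φ := hφ.continuous.integrable_of_hasCompactSupport hc
  have hmean : ∫ x, (φ x - (∫ y, φ y) * η x) = 0 := by
    rw [integral_sub hφi (hηi.const_mul _), integral_const_mul, b.integral_normed, mul_one,
      sub_self]
  have hzero := h.integral_smul_eq_zero (hφ.sub (contDiff_const.mul hη)) (hc.sub hηc.mul_left)
    hmean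
  simp only [sub_smul, mul_smul] at hzero
  have hηf : Integrable fun x => (∫ y, φ y) • η x • f x :=
    (h.1.integrable_smul_left_of_hasCompactSupport hη.continuous hηc).smul _
  rw [integral_sub (h.1.integrable_smul_left_of_hasCompactSupport hφ.continuous hc)
    hηf, integral_smul] at hzero
  rw [integral_smul_const, sub_eq_zero.1 hzero]

theorem HasWeakDeriv.exists_locAC {f g : ℝ → ℝ} (h : HasWeakDeriv f g) :
    ∃ F : ℝ → ℝ, LocAC F g ∧ f =ᵐ[volume] F := by
  have hdiff := h.sub (LocAC.of_integral h.2.1 0).hasWeakDeriv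
  rw [sub_self] at hdiff
  obtain ⟨C, hC⟩ := hdiff.ae_eq_const
  refine ⟨_, LocAC.of_integral h.2.1 C, ?_⟩
  filter_upwards [hC] with x hx
  simpa only [Pi.sub_apply, zero_add, sub_eq_iff_eq_add] using hx

theorem LocAC.weakDeriv_ae_eq {f F F' : ℝ → ℝ} (h : LocAC F F') (hf : f =ᵐ[volume] F) :
    weakDeriv f =ᵐ[volume] F' :=
  (h.hasWeakDeriv.congr hf.symm EventuallyEq.rfl).weakDeriv_ae_eq

theorem LocAC.memH1 {F F' : ℝ → ℝ} (h : LocAC F F') (hF : MemLp F 2) (hF' : MemLp F' 2) :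
    MemH1 F :=
  ⟨hF, F', h.hasWeakDeriv, hF'⟩

theorem MemH1.exists_locAC {f : ℝ → ℝ} (h : MemH1 f) :
    ∃ F F' : ℝ → ℝ, LocAC F F' ∧ f =ᵐ[volume] F ∧ MemLp F 2 ∧ MemLp F' 2 := by
  obtain ⟨hf, g, hg, hgLp⟩ := h
  obtain ⟨F, hF, hfF⟩ := hg.exists_locAC
  exact ⟨F, g, hF, hfF, hf.ae_eq hfF, hgLp⟩

end WeakDerivative

section Madelung

/-- `ρ`, `ρ'`, `N` are the mass density `|w|²`, its derivative and the kinetic density `|w'|²` of a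
function `w ∈ H¹(ℝ; ℂ)`. Only the inequality `|(|w|²)'| ≤ 2 |w| |w'|` is remembered, so that these
triples can be rescaled and compared without referring to `w`. -/
structure IsMadelungTriple (ρ ρ' N : ℝ → ℝ) : Prop where
  locAC : LocAC ρ ρ'
  nonneg : ∀ x, 0 ≤ ρ x
  kinetic_nonneg : ∀ x, 0 ≤ N x
  integrable : Integrable ρ
  integrable_kinetic : Integrable N
  sq_deriv_le : ∀ x, ρ' x ^ 2 ≤ 4 * ρ x * N x

/-- The energy of a Madelung triple. The focusing nonlinearity is encoded by the frequency function
`ν`: its potential energy density is `-ν(ρ) ρ / 2`. -/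
noncomputable def madelungEnergy (k : ℝ) (ν ρ ρ' N : ℝ → ℝ) : ℝ :=
  ∫ x, (1 / 2 * N x + k / 4 * ρ' x ^ 2 - 1 / 2 * (ν (ρ x) * ρ x))

namespace IsMadelungTriple

variable {ρ ρ' N : ℝ → ℝ}

theorem integrable_deriv (h : IsMadelungTriple ρ ρ' N) : Integrable ρ' := by
  refine (h.integrable.add h.integrable_kinetic).mono'
    h.locAC.locallyIntegrable.aestronglyMeasurable (ae_of_all _ fun x => ?_)
  refine abs_le_of_sq_le_sq ?_ (add_nonneg (h.nonneg x) (h.kinetic_nonneg x))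
  rw [Pi.add_apply]
  nlinarith [h.sq_deriv_le x, sq_nonneg (ρ x - N x)]

theorem exists_le (h : IsMadelungTriple ρ ρ' N) : ∃ B, ∀ x, ρ x ≤ B :=
  ⟨∫ t, |ρ' t|, fun x =>
    (le_abs_self _).trans (h.locAC.abs_le_integral_abs h.integrable h.integrable_deriv x)⟩

theorem integrable_sq_deriv (h : IsMadelungTriple ρ ρ' N) : Integrable fun x => ρ' x ^ 2 := by
  obtain ⟨B, hB⟩ := h.exists_le
  refine (h.integrable_kinetic.const_mul (4 * B)).mono'
    (h.locAC.locallyIntegrable.aestronglyMeasurable.pow 2) (ae_of_all _ fun x => ?_)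
  rw [Real.norm_of_nonneg (sq_nonneg _)]
  have := mul_le_mul_of_nonneg_right (hB x) (h.kinetic_nonneg x)
  linarith [h.sq_deriv_le x]

theorem integrable_comp_mul (h : IsMadelungTriple ρ ρ' N) {Q g : ℝ → ℝ} (hQ : Continuous Q)
    (hg : Integrable g) : Integrable fun x => Q (ρ x) * g x := by
  obtain ⟨B, hB⟩ := h.exists_le
  obtain ⟨C, hC⟩ := isCompact_Icc.exists_bound_of_continuousOn (s := Icc 0 B) hQ.continuousOn
  exact hg.bdd_mul (c := C) (hQ.comp h.locAC.continuous).aestronglyMeasurable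
    (ae_of_all _ fun x => hC _ ⟨h.nonneg x, hB x⟩)

theorem const_mul (h : IsMadelungTriple ρ ρ' N) {a : ℝ} (ha : 0 ≤ a) :
    IsMadelungTriple (fun x => a * ρ x) (fun x => a * ρ' x) (fun x => a * N x) where
  locAC := h.locAC.const_mul a
  nonneg x := mul_nonneg ha (h.nonneg x)
  kinetic_nonneg x := mul_nonneg ha (h.kinetic_nonneg x)
  integrable := h.integrable.const_mul a
  integrable_kinetic := h.integrable_kinetic.const_mul a
  sq_deriv_le x := by
    calc (a * ρ' x) ^ 2 = a ^ 2 * ρ' x ^ 2 := mul_pow ..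
      _ ≤ a ^ 2 * (4 * ρ x * N x) := by gcongr; exact h.sq_deriv_le x
      _ = 4 * (a * ρ x) * (a * N x) := by ring

theorem exists_forall_le (h : IsMadelungTriple ρ ρ' N) (hpos : 0 < ∫ x, ρ x) :
    ∃ x₀, 0 < ρ x₀ ∧ ∀ x, ρ x ≤ ρ x₀ := by
  obtain ⟨x₁, hx₁⟩ : ∃ x, 0 < ρ x := by
    by_contra! hle
    exact hpos.not_ge (integral_nonpos hle)
  have hlim : Tendsto ρ (cocompact ℝ) (𝓝 0) := by
    rw [cocompact_eq_atBot_atTop]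
    exact (h.locAC.tendsto_atBot_zero h.integrable h.integrable_deriv).sup
      (h.locAC.tendsto_atTop_zero h.integrable h.integrable_deriv)
  obtain ⟨x₀, hx₀⟩ := h.locAC.continuous.exists_forall_ge' x₁
    ((hlim.eventually_lt_const hx₁).mono fun _ => le_of_lt)
  exact ⟨x₀, hx₁.trans_le (hx₀ x₁), hx₀⟩

variable {ν : ℝ → ℝ}

theorem madelungEnergy_eq (h : IsMadelungTriple ρ ρ' N) (hν : Continuous ν) (k : ℝ) :
    madelungEnergy k ν ρ ρ' N = 1 / 2 * (∫ x, N x) + k / 4 * (∫ x, ρ' x ^ 2)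
      - 1 / 2 * ∫ x, ν (ρ x) * ρ x := by
  have hkin := h.integrable_kinetic.const_mul (1 / 2)
  have hquasi := h.integrable_sq_deriv.const_mul (k / 4)
  have hpot := (h.integrable_comp_mul hν h.integrable).const_mul (1 / 2)
  rw [madelungEnergy, integral_sub (hkin.fun_add hquasi) hpot, integral_add hkin hquasi,
    integral_const_mul, integral_const_mul, integral_const_mul]

theorem integrable_lagrangian (h : IsMadelungTriple ρ ρ' N) (hν : Continuous ν) (k c : ℝ) :
    Integrable fun x => N x + k / 2 * ρ' x ^ 2 + ρ x * (c - ν (ρ x)) := by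
  refine (h.integrable_kinetic.add (h.integrable_sq_deriv.const_mul _)).add ?_
  simp only [mul_comm (ρ _)]
  exact h.integrable_comp_mul (continuous_const.sub hν) h.integrable

theorem integral_lagrangian (h : IsMadelungTriple ρ ρ' N) (hν : Continuous ν) (k c : ℝ) :
    ∫ x, (N x + k / 2 * ρ' x ^ 2 + ρ x * (c - ν (ρ x)))
      = 2 * (madelungEnergy k ν ρ ρ' N + c * (1 / 2 * ∫ x, ρ x)) := by
  have hquasi := h.integrable_sq_deriv.const_mul (k / 2)
  have hkin := h.integrable_kinetic.fun_add hquasi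
  have hmass := h.integrable.mul_const c
  have hpot := h.integrable_comp_mul hν h.integrable
  simp only [mul_sub, ← add_sub_assoc, mul_comm (ρ _) (ν _)]
  rw [integral_sub (hkin.fun_add hmass) hpot, integral_add hkin hmass,
    integral_add h.integrable_kinetic hquasi, integral_const_mul, integral_mul_const,
    h.madelungEnergy_eq hν]
  ring

theorem integral_Iic_comp_mul_deriv (h : IsMadelungTriple ρ ρ' N) {Q : ℝ → ℝ}
    (hQ : Continuous Q) (a : ℝ) :
    ∫ x in Iic a, Q (ρ x) * ρ' x = ∫ s in (0 : ℝ)..ρ a, Q s := by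
  have hprim : ∀ s, HasDerivAt (fun s => ∫ t in (0 : ℝ)..s, Q t) (Q s) s := fun s =>
    (hQ.integral_hasStrictDerivAt 0 s).hasDerivAt
  have hlim := (hprim 0).continuousAt.tendsto.comp
    (h.locAC.tendsto_atBot_zero h.integrable h.integrable_deriv)
  rw [(h.locAC.comp hprim hQ).integral_Iic_of_tendsto
    (h.integrable_comp_mul hQ h.integrable_deriv) hlim, intervalIntegral.integral_same, sub_zero]

theorem integral_Ioi_comp_mul_deriv (h : IsMadelungTriple ρ ρ' N) {Q : ℝ → ℝ}
    (hQ : Continuous Q) (a : ℝ) :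
    ∫ x in Ioi a, Q (ρ x) * ρ' x = -∫ s in (0 : ℝ)..ρ a, Q s := by
  have hprim : ∀ s, HasDerivAt (fun s => ∫ t in (0 : ℝ)..s, Q t) (Q s) s := fun s =>
    (hQ.integral_hasStrictDerivAt 0 s).hasDerivAt
  have hlim := (hprim 0).continuousAt.tendsto.comp
    (h.locAC.tendsto_atTop_zero h.integrable h.integrable_deriv)
  rw [(h.locAC.comp hprim hQ).integral_Ioi_of_tendsto
    (h.integrable_comp_mul hQ h.integrable_deriv) hlim, intervalIntegral.integral_same, zero_sub]

theorem two_mul_integral_le (h : IsMadelungTriple ρ ρ' N) {Q : ℝ → ℝ} (hQ : Continuous Q)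
    (a : ℝ) : 2 * ∫ s in (0 : ℝ)..ρ a, Q s ≤ ∫ x, |Q (ρ x) * ρ' x| := by
  have hint := (h.integrable_comp_mul hQ h.integrable_deriv).abs
  have hleft := (le_abs_self _).trans
    (abs_integral_le_integral_abs (f := fun x => Q (ρ x) * ρ' x) (μ := volume.restrict (Iic a)))
  have hright := (neg_le_abs _).trans
    (abs_integral_le_integral_abs (f := fun x => Q (ρ x) * ρ' x) (μ := volume.restrict (Ioi a)))
  rw [h.integral_Iic_comp_mul_deriv hQ] at hleft
  rw [h.integral_Ioi_comp_mul_deriv hQ, neg_neg] at hright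
  rw [← intervalIntegral.integral_Iic_add_Ioi (b := a) hint.integrableOn hint.integrableOn]
  linarith

theorem two_mul_integral_eq (h : IsMadelungTriple ρ ρ' N) {Q : ℝ → ℝ} (hQ : Continuous Q)
    (hQ₀ : ∀ s, 0 ≤ Q s) {a : ℝ} (hleft : ∀ x ≤ a, 0 ≤ ρ' x) (hright : ∀ x, a ≤ x → ρ' x ≤ 0) :
    2 * ∫ s in (0 : ℝ)..ρ a, Q s = ∫ x, |Q (ρ x) * ρ' x| := by
  have hint := (h.integrable_comp_mul hQ h.integrable_deriv).abs
  have hIic : ∫ x in Iic a, |Q (ρ x) * ρ' x| = ∫ x in Iic a, Q (ρ x) * ρ' x :=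
    setIntegral_congr_fun measurableSet_Iic fun x hx =>
      abs_of_nonneg (mul_nonneg (hQ₀ _) (hleft x hx))
  have hIoi : ∫ x in Ioi a, |Q (ρ x) * ρ' x| = ∫ x in Ioi a, -(Q (ρ x) * ρ' x) :=
    setIntegral_congr_fun measurableSet_Ioi fun x hx =>
      abs_of_nonpos (mul_nonpos_of_nonneg_of_nonpos (hQ₀ _) (hright x (mem_Ioi.1 hx).le))
  rw [← intervalIntegral.integral_Iic_add_Ioi (b := a) hint.integrableOn hint.integrableOn, hIic,
    hIoi, integral_neg, h.integral_Iic_comp_mul_deriv hQ, h.integral_Ioi_comp_mul_deriv hQ]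
  ring

end IsMadelungTriple

end Madelung

section Action

variable {k : ℝ} {ν : ℝ → ℝ}

/-- The slope, in the density variable `s`, of half the action of the orbit of the Newtonian system
for solitons which starts and ends at `0` and whose largest density is `m`. -/
noncomputable def actionDensity (k : ℝ) (ν : ℝ → ℝ) (m s : ℝ) : ℝ :=
  √((1 + 2 * k * s) * (ν m - ν s))

/-- The action of the soliton of maximal density `m`, that is, the smallest value of
`E + ν(m) M / 2` (with `E` the energy and `M` the total mass) among densities with maximum `m`. -/
noncomputable def action (k : ℝ) (ν : ℝ → ℝ) (m : ℝ) : ℝ :=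
  ∫ s in (0 : ℝ)..m, actionDensity k ν m s

theorem continuous_actionDensity (hν : Continuous ν) (k m : ℝ) :
    Continuous (actionDensity k ν m) := by
  unfold actionDensity
  fun_prop

theorem abs_mul_sqrt_le {N r s T : ℝ} (hk : 0 ≤ k) (hs : 0 ≤ s) (hN : 0 ≤ N) (hT : 0 ≤ T)
    (hr : r ^ 2 ≤ 4 * s * N) :
    |√((1 + 2 * k * s) * T) * r| ≤ N + k / 2 * r ^ 2 + s * T := by
  refine abs_le_of_sq_le_sq ?_ (by positivity)
  calc (√((1 + 2 * k * s) * T) * r) ^ 2 = (1 + 2 * k * s) * T * r ^ 2 := by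
        rw [mul_pow, Real.sq_sqrt (by positivity)]
    _ = r ^ 2 * T + 4 * (k / 2 * r ^ 2) * (s * T) := by ring
    _ ≤ 4 * s * N * T + 4 * (k / 2 * r ^ 2) * (s * T) := by gcongr
    _ = 4 * (N + k / 2 * r ^ 2) * (s * T) := by ring
    _ ≤ (N + k / 2 * r ^ 2 + s * T) ^ 2 := four_mul_le_sq_add _ _

theorem abs_sqrt_mul_eq {N r s T : ℝ} (hk : 0 ≤ k) (hs : 0 ≤ s) (hN : 0 ≤ N)
    (hr : r ^ 2 = 4 * s * N) (hT : (1 + 2 * k * s) * N = s * T) :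
    |√((1 + 2 * k * s) * T) * r| = N + k / 2 * r ^ 2 + s * T := by
  have hsT : 0 ≤ s * T := hT ▸ by positivity
  calc |√((1 + 2 * k * s) * T) * r| = √(r ^ 2 * ((1 + 2 * k * s) * T)) := by
        rw [Real.sqrt_mul (sq_nonneg r), Real.sqrt_sq_eq_abs, abs_mul, abs_of_nonneg
          (Real.sqrt_nonneg _), mul_comm]
    _ = √((2 * (s * T)) ^ 2) := by rw [hr]; congr 1; linear_combination 4 * s * T * hT
    _ = 2 * (s * T) := Real.sqrt_sq (by positivity)
    _ = N + k / 2 * r ^ 2 + s * T := by rw [hr]; linear_combination -hT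

namespace IsMadelungTriple

variable {ρ ρ' N : ℝ → ℝ} {x₀ : ℝ}

theorem action_le (h : IsMadelungTriple ρ ρ' N) (hk : 0 ≤ k) (hν : Continuous ν)
    (hmono : MonotoneOn ν (Ici 0)) (hmax : ∀ x, ρ x ≤ ρ x₀) :
    action k ν (ρ x₀) ≤ madelungEnergy k ν ρ ρ' N + ν (ρ x₀) * (1 / 2 * ∫ x, ρ x) := by
  have hQ := continuous_actionDensity hν k (ρ x₀)
  have hyoung : ∫ x, |actionDensity k ν (ρ x₀) (ρ x) * ρ' x|
      ≤ ∫ x, (N x + k / 2 * ρ' x ^ 2 + ρ x * (ν (ρ x₀) - ν (ρ x))) :=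
    integral_mono (h.integrable_comp_mul hQ h.integrable_deriv).abs
      (h.integrable_lagrangian hν k _) fun x =>
        abs_mul_sqrt_le hk (h.nonneg x) (h.kinetic_nonneg x)
          (sub_nonneg.2 (hmono (h.nonneg x) (h.nonneg x₀) (hmax x))) (h.sq_deriv_le x)
  have hbound := (h.two_mul_integral_le hQ x₀).trans hyoung
  rw [h.integral_lagrangian hν] at hbound
  exact le_of_mul_le_mul_left hbound two_pos

theorem action_eq (h : IsMadelungTriple ρ ρ' N) (hk : 0 ≤ k) (hν : Continuous ν)
    (hsq : ∀ x, ρ' x ^ 2 = 4 * ρ x * N x)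
    (hfirst : ∀ x, (1 + 2 * k * ρ x) * N x = ρ x * (ν (ρ x₀) - ν (ρ x)))
    (hleft : ∀ x ≤ x₀, 0 ≤ ρ' x) (hright : ∀ x, x₀ ≤ x → ρ' x ≤ 0) :
    action k ν (ρ x₀) = madelungEnergy k ν ρ ρ' N + ν (ρ x₀) * (1 / 2 * ∫ x, ρ x) := by
  have hyoung : ∫ x, |actionDensity k ν (ρ x₀) (ρ x) * ρ' x|
      = ∫ x, (N x + k / 2 * ρ' x ^ 2 + ρ x * (ν (ρ x₀) - ν (ρ x))) :=
    integral_congr_ae (ae_of_all _ fun x =>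
      abs_sqrt_mul_eq hk (h.nonneg x) (h.kinetic_nonneg x) (hsq x) (hfirst x))
  have heq := (h.two_mul_integral_eq (continuous_actionDensity hν k (ρ x₀))
    (fun _ => Real.sqrt_nonneg _) hleft hright).trans hyoung
  rw [h.integral_lagrangian hν] at heq
  exact mul_left_cancel₀ two_ne_zero heq

end IsMadelungTriple

end Action

section PowerFrequency

variable {θ p : ℝ}

/-- The frequency function of the power nonlinearity: `powerFreq θ p |w|²` is `(2θ/p) |w|^(p-2)`, so
that `θ/p |w|^p` is half of `powerFreq θ p |w|²` times `|w|²`. -/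
noncomputable def powerFreq (θ p s : ℝ) : ℝ := 2 * θ / p * s ^ ((p - 2) / 2)

theorem continuous_powerFreq (θ : ℝ) (hp : 2 ≤ p) : Continuous (powerFreq θ p) :=
  continuous_const.mul (Real.continuous_rpow_const (by linarith))

theorem monotoneOn_powerFreq (hθ : 0 ≤ θ) (hp : 2 ≤ p) : MonotoneOn (powerFreq θ p) (Ici 0) :=
  fun s hs t _ hst => mul_le_mul_of_nonneg_left
    (Real.rpow_le_rpow hs hst (by linarith)) (by positivity)

theorem powerFreq_zero (θ : ℝ) (hp : 2 < p) : powerFreq θ p 0 = 0 := by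
  rw [powerFreq, Real.zero_rpow (by linarith), mul_zero]

theorem powerFreq_pos (hθ : 0 < θ) (hp : 0 < p) {s : ℝ} (hs : 0 < s) : 0 < powerFreq θ p s := by
  unfold powerFreq
  positivity

theorem powerFreq_mul (θ p : ℝ) {a s : ℝ} (ha : 0 ≤ a) (hs : 0 ≤ s) :
    powerFreq θ p (a * s) = a ^ ((p - 2) / 2) * powerFreq θ p s := by
  rw [powerFreq, powerFreq, Real.mul_rpow ha hs]
  ring

theorem half_mul_powerFreq_sq (θ : ℝ) (hp : p ≠ 0) (x : ℝ) :
    p / 2 * powerFreq θ p (x ^ 2) = θ * |x| ^ (p - 2) := by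
  have hpow : (x ^ 2) ^ ((p - 2) / 2) = |x| ^ (p - 2) := by
    rw [← sq_abs, ← Real.rpow_natCast, ← Real.rpow_mul (abs_nonneg x)]
    congr 1
    push_cast
    ring
  rw [powerFreq, hpow]
  field_simp

theorem half_powerFreq_sq_mul_sq (θ : ℝ) (hp : 0 < p) {r : ℝ} (hr : 0 ≤ r) :
    1 / 2 * (powerFreq θ p (r ^ 2) * r ^ 2) = θ / p * r ^ p := by
  have hpow : |r| ^ (p - 2) * r ^ 2 = r ^ p := by
    rcases hr.eq_or_lt with rfl | hr'
    · simp [hp.ne']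
    · rw [abs_of_pos hr', ← Real.rpow_natCast, ← Real.rpow_add hr']
      simp
  linear_combination θ / p * hpow + r ^ 2 / p * half_mul_powerFreq_sq θ hp.ne' r
    - powerFreq θ p (r ^ 2) * r ^ 2 * (1 / 2) * (mul_inv_cancel₀ hp.ne')

theorem exists_powerFreq_eq (hθ : 0 < θ) (hp : 2 < p) {μ : ℝ} (hμ : 0 < μ) :
    ∃ m, 0 < m ∧ powerFreq θ p m = μ := by
  refine ⟨(p * μ / (2 * θ)) ^ (2 / (p - 2)), by positivity, ?_⟩
  have hexp : 2 / (p - 2) * ((p - 2) / 2) = 1 := by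
    have : p - 2 ≠ 0 := by linarith
    field_simp
  rw [powerFreq, ← Real.rpow_mul (by positivity), hexp, Real.rpow_one]
  have : p ≠ 0 := by linarith
  field_simp

end PowerFrequency

section Energy

theorem MemH1.exists_isMadelungTriple {w : ℝ → ℂ} (h : MemH1 w) :
    ∃ ρ ρ' N : ℝ → ℝ, IsMadelungTriple ρ ρ' N ∧ (∀ᵐ x, ‖w x‖ ^ 2 = ρ x) ∧
      ∀ᵐ x, ‖weakDeriv w x‖ ^ 2 = N x := by
  obtain ⟨hw, g, hg, hgLp⟩ := h
  obtain ⟨A, hA, hwA⟩ := (hg.clm_comp Complex.reCLM).exists_locAC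
  obtain ⟨B, hB, hwB⟩ := (hg.clm_comp Complex.imCLM).exists_locAC
  simp only [Complex.reCLM_apply, Complex.imCLM_apply] at hA hB hwA hwB
  have hnorm : ∀ z : ℂ, ‖z‖ ^ 2 = z.re ^ 2 + z.im ^ 2 := fun z => by
    rw [Complex.sq_norm, Complex.normSq_apply]
    ring
  refine ⟨fun x => A x ^ 2 + B x ^ 2, _, fun x => (g x).re ^ 2 + (g x).im ^ 2,
    { locAC := hA.sq.add hB.sq
      nonneg := fun x => by positivity
      kinetic_nonneg := fun x => by positivity
      integrable := (hw.re.ae_eq hwA).integrable_sq.add (hw.im.ae_eq hwB).integrable_sq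
      integrable_kinetic := hgLp.re.integrable_sq.add hgLp.im.integrable_sq
      sq_deriv_le := fun x => ?_ }, ?_, ?_⟩
  · nlinarith [sq_nonneg (A x * (g x).im - B x * (g x).re)]
  · filter_upwards [hwA, hwB] with x hxA hxB
    rw [hnorm, hxA, hxB]
  · filter_upwards [hg.weakDeriv_ae_eq] with x hx
    rw [hx, hnorm]

theorem energy_eq_madelungEnergy {k θ p : ℝ} (hp : 0 < p) {w : ℝ → ℂ} {ρ ρ' N : ℝ → ℝ}
    (hρ : LocAC ρ ρ') (hw : ∀ᵐ x, ‖w x‖ ^ 2 = ρ x) (hw' : ∀ᵐ x, ‖weakDeriv w x‖ ^ 2 = N x) :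
    energy k θ p w = madelungEnergy k (powerFreq θ p) ρ ρ' N := by
  refine integral_congr_ae ?_
  filter_upwards [hw, hw', hρ.weakDeriv_ae_eq hw] with x hx hx' hxd
  rw [hxd, hx', ← half_powerFreq_sq_mul_sq θ hp (norm_nonneg (w x)), hx]

end Energy

section ReducedEnergy

variable {k θ p lam m : ℝ}

/-- The smallest energy compatible, by `IsMadelungTriple.action_le`, with a density of maximum `m`
whose mass, in the normalisation `∫ ρ / 2`, is `lam`. -/
noncomputable def reducedEnergy (k : ℝ) (ν : ℝ → ℝ) (lam m : ℝ) : ℝ := action k ν m - ν m * lam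

/-- The action of a soliton for the power nonlinearity as a function of its maximal density `m`,
after scaling out `m √ν(m)`. The dependence on `m` that remains is due to the quasilinear term. -/
noncomputable def actionShape (k p m : ℝ) : ℝ :=
  ∫ τ in (0 : ℝ)..1, √((1 + 2 * k * m * τ) * (1 - τ ^ ((p - 2) / 2)))

theorem action_powerFreq (k : ℝ) (hθ : 0 ≤ θ) (hp : 2 ≤ p) (hm : 0 ≤ m) :
    action k (powerFreq θ p) m = m * √(powerFreq θ p m) * actionShape k p m := by
  have hν : 0 ≤ powerFreq θ p m := by
    unfold powerFreq
    positivity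
  have hscale : ∀ τ ∈ uIcc (0 : ℝ) 1, actionDensity k (powerFreq θ p) m (m * τ)
      = √(powerFreq θ p m) * √((1 + 2 * k * m * τ) * (1 - τ ^ ((p - 2) / 2))) := fun τ hτ => by
    rw [uIcc_of_le zero_le_one] at hτ
    rw [actionDensity, mul_comm m, powerFreq_mul θ p hτ.1 hm, ← Real.sqrt_mul hν]
    ring_nf
  have hsubst := intervalIntegral.mul_integral_comp_mul_left
    (f := actionDensity k (powerFreq θ p) m) (a := 0) (b := 1) m
  rw [mul_zero, mul_one] at hsubst
  rw [action, ← hsubst, intervalIntegral.integral_congr hscale,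
    intervalIntegral.integral_const_mul, actionShape, ← mul_assoc m]

theorem continuous_actionShape (k : ℝ) (hp : 2 ≤ p) : Continuous (actionShape k p) := by
  have hpow : Continuous fun τ : ℝ => τ ^ ((p - 2) / 2) :=
    Real.continuous_rpow_const (by linarith)
  refine intervalIntegral.continuous_parametric_intervalIntegral_of_continuous' ?_ 0 1
  fun_prop

theorem actionShape_zero_pos (k : ℝ) (hp : 2 < p) : 0 < actionShape k p 0 := by
  have hpow : Continuous fun τ : ℝ => τ ^ ((p - 2) / 2) :=
    Real.continuous_rpow_const (by linarith)
  refine intervalIntegral.intervalIntegral_pos_of_pos_on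
    (Continuous.intervalIntegrable (by fun_prop) _ _) (fun τ hτ => ?_) zero_lt_one
  have hlt : τ ^ ((p - 2) / 2) < 1 := Real.rpow_lt_one hτ.1.le hτ.2 (by linarith)
  have : 0 < 1 - τ ^ ((p - 2) / 2) := sub_pos.2 hlt
  rw [mul_zero, zero_mul, add_zero, one_mul]
  positivity

theorem actionShape_zero_le (hk : 0 ≤ k) (hp : 2 ≤ p) (hm : 0 ≤ m) :
    actionShape k p 0 ≤ actionShape k p m := by
  have hpow : Continuous fun τ : ℝ => τ ^ ((p - 2) / 2) :=
    Real.continuous_rpow_const (by linarith)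
  refine intervalIntegral.integral_mono_on zero_le_one
    (Continuous.intervalIntegrable (by fun_prop) _ _)
    (Continuous.intervalIntegrable (by fun_prop) _ _) fun τ hτ => ?_
  have hle : 0 ≤ 1 - τ ^ ((p - 2) / 2) :=
    sub_nonneg.2 (Real.rpow_le_one hτ.1 hτ.2 (by linarith))
  have := hτ.1
  gcongr

theorem continuousOn_reducedEnergy (k lam : ℝ) (hθ : 0 ≤ θ) (hp : 2 ≤ p) :
    ContinuousOn (reducedEnergy k (powerFreq θ p) lam) (Ici 0) := by
  have hν := continuous_powerFreq θ hp
  have hcont : Continuous fun m =>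
      m * √(powerFreq θ p m) * actionShape k p m - powerFreq θ p m * lam :=
    ((continuous_id.mul hν.sqrt).mul (continuous_actionShape k hp)).sub (hν.mul_const lam)
  exact hcont.continuousOn.congr fun m hm => by
    rw [reducedEnergy, action_powerFreq k hθ hp hm]

theorem reducedEnergy_eq (k lam : ℝ) (hθ : 0 ≤ θ) (hp : 2 ≤ p) (hm : 0 < m) :
    reducedEnergy k (powerFreq θ p) lam m = √(powerFreq θ p m) * m ^ ((p - 2) / 4) *
      (actionShape k p m * m ^ ((6 - p) / 4) - √(2 * θ / p) * lam) := by
  have hsqrt : √(powerFreq θ p m) = √(2 * θ / p) * m ^ ((p - 2) / 4) := by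
    rw [powerFreq, Real.sqrt_mul (by positivity), Real.sqrt_eq_rpow (m ^ _), ← Real.rpow_mul hm.le]
    ring_nf
  have hm' : m ^ ((p - 2) / 4) * m ^ ((6 - p) / 4) = m := by
    rw [← Real.rpow_add hm]
    ring_nf
    exact Real.rpow_one m
  have hν : √(powerFreq θ p m) ^ 2 = powerFreq θ p m := Real.sq_sqrt (by
    unfold powerFreq
    positivity)
  rw [reducedEnergy, action_powerFreq k hθ hp hm.le]
  linear_combination lam * hν - √(powerFreq θ p m) * lam * hsqrt
    - √(powerFreq θ p m) * actionShape k p m * hm'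

theorem exists_reducedEnergy_neg (k : ℝ) (hθ : 0 < θ) (hp2 : 2 ≤ p) (hp6 : p < 6)
    (hlam : 0 < lam) : ∃ m, 0 < m ∧ reducedEnergy k (powerFreq θ p) lam m < 0 := by
  have hcont : Continuous fun m => actionShape k p m * m ^ ((6 - p) / 4) :=
    (continuous_actionShape k hp2).mul (Real.continuous_rpow_const (by linarith))
  have hlim := hcont.tendsto 0
  rw [Real.zero_rpow (by linarith), mul_zero] at hlim
  have hsmall : ∀ᶠ m in 𝓝[>] 0, actionShape k p m * m ^ ((6 - p) / 4) < √(2 * θ / p) * lam :=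
    (hlim.mono_left nhdsWithin_le_nhds).eventually_lt_const (by positivity)
  obtain ⟨m, hm, hm0⟩ := (hsmall.and self_mem_nhdsWithin).exists
  refine ⟨m, hm0, ?_⟩
  rw [reducedEnergy_eq k lam hθ.le hp2 hm0]
  have hν := powerFreq_pos hθ (by linarith : 0 < p) hm0
  have : 0 < m := hm0
  exact mul_neg_of_pos_of_neg (by positivity) (sub_neg.2 hm)

theorem eventually_reducedEnergy_nonneg (lam : ℝ) (hk : 0 ≤ k) (hθ : 0 ≤ θ) (hp2 : 2 < p)
    (hp6 : p < 6) : ∀ᶠ m in atTop, 0 ≤ reducedEnergy k (powerFreq θ p) lam m := by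
  have hlim : Tendsto (fun m => actionShape k p 0 * m ^ ((6 - p) / 4)) atTop atTop :=
    (tendsto_rpow_atTop (by linarith)).const_mul_atTop (actionShape_zero_pos k hp2)
  filter_upwards [hlim.eventually_ge_atTop (√(2 * θ / p) * lam), eventually_gt_atTop 0]
    with m hm hm0
  rw [reducedEnergy_eq k lam hθ hp2.le hm0]
  refine mul_nonneg (by positivity) (sub_nonneg.2 (hm.trans ?_))
  gcongr
  exact actionShape_zero_le hk hp2.le hm0.le

theorem exists_isMinOn_reducedEnergy (hk : 0 ≤ k) (hθ : 0 < θ) (hp2 : 2 < p) (hp6 : p < 6)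
    (hlam : 0 < lam) : ∃ m, 0 < m ∧ IsMinOn (reducedEnergy k (powerFreq θ p) lam) (Ioi 0) m := by
  obtain ⟨m₁, hm₁, hneg⟩ := exists_reducedEnergy_neg k hθ hp2.le hp6 hlam
  obtain ⟨R, hR⟩ := eventually_atTop.1
    (eventually_reducedEnergy_nonneg lam hk hθ.le hp2 hp6)
  obtain ⟨m, hm, hmin⟩ := isCompact_Icc.exists_isMinOn (s := Icc 0 (max m₁ R))
    ⟨0, left_mem_Icc.2 (hm₁.le.trans (le_max_left _ _))⟩
    ((continuousOn_reducedEnergy k lam hθ.le hp2.le).mono Icc_subset_Ici_self)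
  have hmneg : reducedEnergy k (powerFreq θ p) lam m < 0 :=
    (hmin ⟨hm₁.le, le_max_left _ _⟩).trans_lt hneg
  refine ⟨m, hm.1.lt_of_ne' fun h0 => ?_, fun s hs => ?_⟩
  · rw [h0, reducedEnergy, action, intervalIntegral.integral_same, powerFreq_zero θ hp2] at hmneg
    simp at hmneg
  · rcases le_total s (max m₁ R) with hsR | hsR
    · exact hmin ⟨(mem_Ioi.1 hs).le, hsR⟩
    · exact hmneg.le.trans (hR s ((le_max_right _ _).trans hsR))

end ReducedEnergy

section Mass

theorem amplitude_stationary {T R S M μ e lam : ℝ}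
    (hmin : IsLocalMin
      (fun a : ℝ => a * T + a ^ 2 * R - a ^ e * (a * S) + a ^ e * μ * (a * M - lam)) 1) :
    T + 2 * R - (e + 1) * S + μ * M + e * μ * (M - lam) = 0 := by
  have hpow : HasDerivAt (fun a : ℝ => a ^ e) e 1 := by
    simpa using Real.hasDerivAt_rpow_const (x := 1) (p := e) (Or.inl one_ne_zero)
  have hderiv := ((((hasDerivAt_id (1 : ℝ)).mul_const T).add
    (((hasDerivAt_id (1 : ℝ)).pow 2).mul_const R)).sub
    (hpow.mul ((hasDerivAt_id (1 : ℝ)).mul_const S))).add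
    ((hpow.mul_const μ).mul (((hasDerivAt_id (1 : ℝ)).mul_const M).sub_const lam))
  have hzero := hmin.hasDerivAt_eq_zero hderiv
  simp only [one_mul, Nat.cast_ofNat, id_eq, Nat.add_one_sub_one, one_pow, mul_one,
    Real.one_rpow] at hzero
  linear_combination hzero

namespace IsMadelungTriple

variable {k θ p lam x₀ : ℝ} {ρ ρ' N : ℝ → ℝ}

theorem madelungEnergy_const_mul (h : IsMadelungTriple ρ ρ' N) (k θ : ℝ) (hp : 2 ≤ p) {a : ℝ}
    (ha : 0 ≤ a) :
    madelungEnergy k (powerFreq θ p) (fun x => a * ρ x) (fun x => a * ρ' x) (fun x => a * N x)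
      = a * (1 / 2 * ∫ x, N x) + a ^ 2 * (k / 4 * ∫ x, ρ' x ^ 2)
        - a ^ ((p - 2) / 2) * (a * (1 / 2 * ∫ x, powerFreq θ p (ρ x) * ρ x)) := by
  have hpot : ∀ x, powerFreq θ p (a * ρ x) * (a * ρ x)
      = a ^ ((p - 2) / 2) * a * (powerFreq θ p (ρ x) * ρ x) := fun x => by
    rw [powerFreq_mul θ p ha (h.nonneg x)]
    ring
  rw [(h.const_mul ha).madelungEnergy_eq (continuous_powerFreq θ hp)]
  simp only [hpot, mul_pow, integral_const_mul]
  ring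

theorem reducedEnergy_le (h : IsMadelungTriple ρ ρ' N) (hk : 0 ≤ k) (hθ : 0 ≤ θ) (hp : 2 ≤ p)
    (hmax : ∀ x, ρ x ≤ ρ x₀) (lam : ℝ) :
    reducedEnergy k (powerFreq θ p) lam (ρ x₀) ≤ madelungEnergy k (powerFreq θ p) ρ ρ' N
      + powerFreq θ p (ρ x₀) * (1 / 2 * (∫ x, ρ x) - lam) := by
  have := h.action_le hk (continuous_powerFreq θ hp) (monotoneOn_powerFreq hθ hp) hmax
  rw [reducedEnergy]
  linarith

/-- The amplitudes `a ρ` compete with `ρ` for the minimum of the reduced energy. Stationarity at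
`a = 1`, corrected by the Nehari identity, leaves a multiple of the mass defect. -/
theorem mass_eq_of_isMinOn (h : IsMadelungTriple ρ ρ' N) (hk : 0 ≤ k) (hθ : 0 < θ) (hp : 2 < p)
    (hmax : ∀ x, ρ x ≤ ρ x₀) (hpos : 0 < ρ x₀)
    (haction : action k (powerFreq θ p) (ρ x₀)
      = madelungEnergy k (powerFreq θ p) ρ ρ' N + powerFreq θ p (ρ x₀) * (1 / 2 * ∫ x, ρ x))
    (hnehari : (∫ x, N x) + powerFreq θ p (ρ x₀) * (∫ x, ρ x) + k * (∫ x, ρ' x ^ 2)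
      - p / 2 * (∫ x, powerFreq θ p (ρ x) * ρ x) = 0)
    (hmin : IsMinOn (reducedEnergy k (powerFreq θ p) lam) (Ioi 0) (ρ x₀)) :
    1 / 2 * ∫ x, ρ x = lam := by
  set e := (p - 2) / 2 with he
  set μ := powerFreq θ p (ρ x₀) with hμ
  set T := 1 / 2 * ∫ x, N x with hT
  set R := k / 4 * ∫ x, ρ' x ^ 2 with hR
  set S := 1 / 2 * ∫ x, powerFreq θ p (ρ x) * ρ x with hS
  set M := 1 / 2 * ∫ x, ρ x with hM
  let f : ℝ → ℝ := fun a => a * T + a ^ 2 * R - a ^ e * (a * S) + a ^ e * μ * (a * M - lam)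
  have hreduced : reducedEnergy k (powerFreq θ p) lam (ρ x₀) = f 1 := by
    rw [reducedEnergy, haction, h.madelungEnergy_eq (continuous_powerFreq θ hp.le)]
    simp only [f, Real.one_rpow, ← hμ, ← hT, ← hR, ← hS]
    ring
  have hlocal : IsLocalMin f 1 := by
    filter_upwards [Ioi_mem_nhds zero_lt_one] with a ha
    have ha' : 0 ≤ a := le_of_lt ha
    have hle := (h.const_mul ha').reducedEnergy_le hk hθ.le hp.le
      (fun x => mul_le_mul_of_nonneg_left (hmax x) ha') lam
    rw [h.madelungEnergy_const_mul k θ hp.le ha', powerFreq_mul θ p ha' hpos.le,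
      integral_const_mul] at hle
    calc f 1 ≤ reducedEnergy k (powerFreq θ p) lam (a * ρ x₀) :=
          hreduced ▸ hmin (mem_Ioi.2 (mul_pos ha hpos))
      _ ≤ _ := hle
      _ = f a := by simp only [f, ← hμ, ← hT, ← hR, ← hS, ← he, hM]; ring
  have hzero := amplitude_stationary hlocal
  have hdefect : e * μ * (M - lam) = 0 := by
    linear_combination hzero - 1 / 2 * hnehari
  have heμ : e * μ ≠ 0 := (mul_pos (by linarith) (powerFreq_pos hθ (by linarith) hpos)).ne'
  exact sub_eq_zero.1 ((mul_eq_zero.1 hdefect).resolve_left heμ)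

end IsMadelungTriple

end Mass

section Calculus

theorem hasDerivAt_tanh (z : ℝ) : HasDerivAt Real.tanh (1 - Real.tanh z ^ 2) z := by
  have hc := (Real.cosh_pos z).ne'
  have hdiv := (Real.hasDerivAt_sinh z).div (Real.hasDerivAt_cosh z) hc
  refine (hdiv.congr_of_eventuallyEq (Eventually.of_forall
    Real.tanh_eq_sinh_div_cosh)).congr_deriv ?_
  rw [Real.tanh_eq_sinh_div_cosh]
  field_simp

theorem one_sub_tanh_sq (z : ℝ) : 1 - Real.tanh z ^ 2 = Real.cosh z ^ (-2 : ℝ) := by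
  have hc := (Real.cosh_pos z).ne'
  rw [Real.rpow_neg (Real.cosh_pos z).le, Real.rpow_two, Real.tanh_eq_sinh_div_cosh, div_pow,
    Real.sinh_sq]
  field_simp
  ring

theorem mul_abs_le_abs_of_le_deriv {f f' : ℝ → ℝ} {c : ℝ} (hf : ∀ x, HasDerivAt f (f' x) x)
    (h0 : f 0 = 0) (hc : ∀ x, c ≤ f' x) (x : ℝ) : c * |x| ≤ |f x| := by
  have hle : ∀ ⦃a b⦄, a ≤ b → c * (b - a) ≤ f b - f a :=
    mul_sub_le_image_sub_of_le_deriv (fun x => (hf x).differentiableAt)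
      fun x => (hf x).deriv ▸ hc x
  rcases le_total 0 x with hx | hx
  · rw [abs_of_nonneg hx]
    have := hle hx
    rw [h0, sub_zero, sub_zero] at this
    exact this.trans (le_abs_self _)
  · rw [abs_of_nonpos hx]
    have := hle hx
    rw [h0, zero_sub, zero_sub] at this
    exact this.trans (neg_le_abs _)

theorem surjective_of_le_deriv {f f' : ℝ → ℝ} {c : ℝ} (hc : 0 < c)
    (hf : ∀ x, HasDerivAt f (f' x) x) (hle : ∀ x, c ≤ f' x) : Function.Surjective f := by
  have hmvt : ∀ ⦃a b⦄, a ≤ b → c * (b - a) ≤ f b - f a :=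
    mul_sub_le_image_sub_of_le_deriv (fun x => (hf x).differentiableAt)
      fun x => (hf x).deriv ▸ hle x
  have hlin : Tendsto (fun x => c * x) atTop atTop := tendsto_id.const_mul_atTop hc
  have hlin' : Tendsto (fun x => c * x) atBot atBot := tendsto_id.const_mul_atBot hc
  refine (continuous_iff_continuousAt.2 fun x => (hf x).continuousAt).surjective
    (tendsto_atTop_mono' atTop ?_ (tendsto_atTop_add_const_right _ (f 0) hlin))
    (tendsto_atBot_mono' atBot ?_ (tendsto_atBot_add_const_right _ (f 0) hlin'))
  · filter_upwards [eventually_ge_atTop 0] with x hx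
    linarith [hmvt hx]
  · filter_upwards [eventually_le_atBot 0] with x hx
    linarith [hmvt hx]

/-- Separation of variables: the solution inverts `∫ 1 / g`. -/
theorem exists_forall_hasDerivAt_comp {g : ℝ → ℝ} {b : ℝ} (hg : Continuous g)
    (hpos : ∀ z, 0 < g z) (hb : ∀ z, g z ≤ b) :
    ∃ z : ℝ → ℝ, z 0 = 0 ∧ ∀ x, HasDerivAt z (g (z x)) x := by
  have hinv : Continuous fun s => (g s)⁻¹ := hg.inv₀ fun s => (hpos s).ne'
  let X : ℝ → ℝ := fun z => ∫ s in (0 : ℝ)..z, (g s)⁻¹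
  have hX : ∀ z, HasDerivAt X (g z)⁻¹ z := fun z =>
    (hinv.integral_hasStrictDerivAt 0 z).hasDerivAt
  have hsurj : Function.Surjective X :=
    surjective_of_le_deriv (inv_pos.2 ((hpos 0).trans_le (hb 0))) hX
      fun z => inv_anti₀ (hpos z) (hb z)
  have hmono : StrictMono X := strictMono_of_hasDerivAt_pos hX fun z => inv_pos.2 (hpos z)
  let z := (hmono.orderIsoOfSurjective X hsurj).symm
  have hz : ∀ x, X (z x) = x := (hmono.orderIsoOfSurjective X hsurj).apply_symm_apply
  refine ⟨z, hmono.injective ?_, fun x => ?_⟩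
  · rw [hz]
    exact intervalIntegral.integral_same.symm
  · rw [← inv_inv (g (z x))]
    exact (hX (z x)).of_local_left_inverse z.continuous.continuousAt
      (inv_pos.2 (hpos _)).ne' (Eventually.of_forall hz)

theorem integrable_exp_neg_mul_abs {δ : ℝ} (hδ : 0 < δ) :
    Integrable fun x : ℝ => Real.exp (-(δ * |x|)) := by
  have hδ' : δ / 2 ≠ 0 := by positivity
  refine (integrable_inv_one_add_sq.comp_mul_left' hδ').mono'
    (Continuous.aestronglyMeasurable (by fun_prop)) (ae_of_all _ fun x => ?_)
  rw [Real.norm_of_nonneg (Real.exp_pos _).le, Real.exp_neg]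
  refine inv_anti₀ (by positivity) ?_
  have hx : 0 ≤ δ / 2 * |x| := by positivity
  calc 1 + (δ / 2 * x) ^ 2 = 1 + (δ / 2 * |x|) ^ 2 := by rw [mul_pow, mul_pow, sq_abs]
    _ ≤ (δ / 2 * |x| + 1) ^ 2 := by nlinarith
    _ ≤ Real.exp (δ / 2 * |x|) ^ 2 := by gcongr; exact Real.add_one_le_exp _
    _ = Real.exp (δ * |x|) := by rw [← Real.exp_nat_mul]; ring_nf

end Calculus

section SemilinearProfile

variable {p m : ℝ}

/-- The soliton of maximal density `m` of the semilinear equation (`k = 0`), in the rescaled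
variable that makes it a power of the hyperbolic secant. -/
noncomputable def semilinearProfile (p m z : ℝ) : ℝ := √m * Real.cosh z ^ (-(2 / (p - 2)))

theorem semilinearProfile_pos (p : ℝ) (hm : 0 < m) (z : ℝ) : 0 < semilinearProfile p m z :=
  mul_pos (Real.sqrt_pos.2 hm) (Real.rpow_pos_of_pos (Real.cosh_pos z) _)

theorem semilinearProfile_sq (p : ℝ) (hm : 0 ≤ m) (z : ℝ) :
    semilinearProfile p m z ^ 2 = Real.cosh z ^ (-(4 / (p - 2))) * m := by
  rw [semilinearProfile, mul_pow, Real.sq_sqrt hm, ← Real.rpow_natCast (_ ^ _),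
    ← Real.rpow_mul (Real.cosh_pos z).le, mul_comm]
  push_cast
  ring_nf

theorem semilinearProfile_sq_le (hp : 2 < p) (hm : 0 ≤ m) (z : ℝ) :
    semilinearProfile p m z ^ 2 ≤ m := by
  rw [semilinearProfile_sq p hm]
  have : 0 < 4 / (p - 2) := div_pos (by norm_num) (by linarith)
  exact mul_le_of_le_one_left hm
    (Real.rpow_le_one_of_one_le_of_nonpos (Real.one_le_cosh z) (by linarith))

theorem semilinearProfile_sq_le_exp (hp : 2 < p) (hm : 0 ≤ m) (z : ℝ) :
    semilinearProfile p m z ^ 2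
      ≤ 2 ^ (4 / (p - 2)) * m * Real.exp (-(4 / (p - 2) * |z|)) := by
  have hr : 0 < 4 / (p - 2) := div_pos (by norm_num) (by linarith)
  have hcosh : Real.exp |z| / 2 ≤ Real.cosh z := by
    rw [Real.cosh_eq]
    linarith [Real.exp_abs_le z]
  calc semilinearProfile p m z ^ 2 = Real.cosh z ^ (-(4 / (p - 2))) * m :=
        semilinearProfile_sq p hm z
    _ ≤ (Real.exp |z| / 2) ^ (-(4 / (p - 2))) * m :=
        mul_le_mul_of_nonneg_right
          (Real.rpow_le_rpow_of_nonpos (by positivity) hcosh (by linarith)) hm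
    _ = 2 ^ (4 / (p - 2)) * m * Real.exp (-(4 / (p - 2) * |z|)) := by
        rw [Real.div_rpow (Real.exp_pos _).le zero_le_two, ← Real.exp_mul,
          Real.rpow_neg zero_le_two, div_inv_eq_mul]
        ring_nf

theorem hasDerivAt_semilinearProfile (p m z : ℝ) :
    HasDerivAt (semilinearProfile p m)
      (-(2 / (p - 2)) * semilinearProfile p m z * Real.tanh z) z := by
  have hc := (Real.cosh_pos z).ne'
  refine (((Real.hasDerivAt_cosh z).rpow_const (p := -(2 / (p - 2)))
    (Or.inl hc)).const_mul (√m)).congr_deriv ?_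
  rw [Real.rpow_sub_one hc, Real.tanh_eq_sinh_div_cosh, semilinearProfile]
  ring

theorem continuous_semilinearProfile (p m : ℝ) : Continuous (semilinearProfile p m) :=
  continuous_iff_continuousAt.2 fun z => (hasDerivAt_semilinearProfile p m z).continuousAt

theorem powerFreq_semilinearProfile_sq (θ : ℝ) (hp : 2 < p) (hm : 0 ≤ m) (z : ℝ) :
    powerFreq θ p (semilinearProfile p m z ^ 2) = powerFreq θ p m * (1 - Real.tanh z ^ 2) := by
  have hexp : -(4 / (p - 2)) * ((p - 2) / 2) = -2 := by
    have : p - 2 ≠ 0 := by linarith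
    field_simp
    norm_num
  rw [semilinearProfile_sq p hm, powerFreq_mul θ p (Real.rpow_nonneg (Real.cosh_pos z).le _) hm,
    ← Real.rpow_mul (Real.cosh_pos z).le, hexp, one_sub_tanh_sq, mul_comm]

end SemilinearProfile

section Soliton

/-- A positive solitary wave `u`, with derivative `u'`, of the equation of frequency
`powerFreq θ p m`, which rises on the left of the origin to its maximal density `u² = m` there and
falls on the right. `equation` is the differential equation with its quasilinear part in divergence
form, and `first_integral` its conserved quantity on the zero level. -/
structure IsSoliton (k θ p m : ℝ) (u u' : ℝ → ℝ) : Prop where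
  hasDerivAt : ∀ x, HasDerivAt u (u' x) x
  continuous_deriv : Continuous u'
  pos : ∀ x, 0 < u x
  sq_le : ∀ x, u x ^ 2 ≤ m
  apply_zero : u 0 ^ 2 = m
  deriv_nonneg : ∀ x ≤ 0, 0 ≤ u' x
  deriv_nonpos : ∀ x, 0 ≤ x → u' x ≤ 0
  first_integral : ∀ x, (1 + 2 * k * u x ^ 2) * u' x ^ 2
    = u x ^ 2 * (powerFreq θ p m - powerFreq θ p (u x ^ 2))
  equation : ∀ x, HasDerivAt (fun x => (1 + 2 * k * u x ^ 2) * u' x)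
    ((2 * k * u' x ^ 2 + powerFreq θ p m - p / 2 * powerFreq θ p (u x ^ 2)) * u x) x
  integrable_sq : Integrable fun x => u x ^ 2

/-- The change of variable `z` that turns the semilinear profile into the quasilinear soliton. -/
structure IsSolitonPhase (k θ p m : ℝ) (z : ℝ → ℝ) : Prop where
  apply_zero : z 0 = 0
  hasDerivAt : ∀ x, HasDerivAt z
    ((p - 2) / 2 * √(powerFreq θ p m) / √(1 + 2 * k * semilinearProfile p m (z x) ^ 2)) x

/-- The derivative of the soliton, as a function of its phase. -/
noncomputable def solitonSlope (k θ p m z : ℝ) : ℝ :=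
  -√(powerFreq θ p m) * (semilinearProfile p m z * Real.tanh z)
    / √(1 + 2 * k * semilinearProfile p m z ^ 2)

variable {k θ p m : ℝ}

theorem one_le_sqrt_one_add (hk : 0 ≤ k) (s : ℝ) : 1 ≤ √(1 + 2 * k * s ^ 2) :=
  Real.one_le_sqrt.2 (le_add_of_nonneg_right (by positivity))

theorem exists_isSolitonPhase (hk : 0 ≤ k) (hθ : 0 < θ) (hp : 2 < p) (hm : 0 < m) :
    ∃ z, IsSolitonPhase k θ p m z := by
  have hone := one_le_sqrt_one_add hk
  have hpos := fun s => zero_lt_one.trans_le (hone s)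
  have hspeed : 0 < (p - 2) / 2 * √(powerFreq θ p m) :=
    mul_pos (by linarith) (Real.sqrt_pos.2 (powerFreq_pos hθ (by linarith) hm))
  have hprofile := continuous_semilinearProfile p m
  obtain ⟨z, hz0, hz⟩ := exists_forall_hasDerivAt_comp
    (g := fun z => (p - 2) / 2 * √(powerFreq θ p m) / √(1 + 2 * k * semilinearProfile p m z ^ 2))
    (continuous_const.div (by fun_prop) fun z => (hpos _).ne')
    (fun z => div_pos hspeed (hpos _)) fun z => div_le_self hspeed.le (hone _)
  exact ⟨z, hz0, hz⟩

theorem sqrt_mul_solitonSlope (hk : 0 ≤ k) (θ p m z : ℝ) :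
    √(1 + 2 * k * semilinearProfile p m z ^ 2) * solitonSlope k θ p m z
      = -√(powerFreq θ p m) * (semilinearProfile p m z * Real.tanh z) :=
  mul_div_cancel₀ _ (zero_lt_one.trans_le (one_le_sqrt_one_add hk _)).ne'

theorem mul_solitonSlope_sq (hk : 0 ≤ k) (hθ : 0 < θ) (hp : 2 < p) (hm : 0 < m) (z : ℝ) :
    (1 + 2 * k * semilinearProfile p m z ^ 2) * solitonSlope k θ p m z ^ 2
      = powerFreq θ p m * (semilinearProfile p m z ^ 2 * Real.tanh z ^ 2) := by
  calc (1 + 2 * k * semilinearProfile p m z ^ 2) * solitonSlope k θ p m z ^ 2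
      = (√(1 + 2 * k * semilinearProfile p m z ^ 2) * solitonSlope k θ p m z) ^ 2 := by
        rw [mul_pow, Real.sq_sqrt (by positivity)]
    _ = √(powerFreq θ p m) ^ 2 * (semilinearProfile p m z ^ 2 * Real.tanh z ^ 2) := by
        rw [sqrt_mul_solitonSlope hk]
        ring
    _ = powerFreq θ p m * (semilinearProfile p m z ^ 2 * Real.tanh z ^ 2) := by
        rw [Real.sq_sqrt (powerFreq_pos hθ (by linarith) hm).le]

theorem continuous_solitonSlope (hk : 0 ≤ k) (θ p m : ℝ) : Continuous (solitonSlope k θ p m) := by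
  have hprofile := continuous_semilinearProfile p m
  have htanh : Continuous Real.tanh :=
    continuous_iff_continuousAt.2 fun z => (hasDerivAt_tanh z).continuousAt
  exact (continuous_const.mul (hprofile.mul htanh)).div (by fun_prop)
    fun z => (zero_lt_one.trans_le (one_le_sqrt_one_add hk _)).ne'

theorem solitonSlope_nonneg_of_nonpos (k θ p : ℝ) (hm : 0 < m) {z : ℝ} (hz : z ≤ 0) :
    0 ≤ solitonSlope k θ p m z := by
  have htanh : Real.tanh z ≤ 0 := by
    rw [Real.tanh_eq_sinh_div_cosh]
    exact div_nonpos_of_nonpos_of_nonneg (Real.sinh_nonpos_iff.2 hz) (Real.cosh_pos z).le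
  exact div_nonneg (mul_nonneg_of_nonpos_of_nonpos (neg_nonpos.2 (Real.sqrt_nonneg _))
    (mul_nonpos_of_nonneg_of_nonpos (semilinearProfile_pos p hm z).le htanh)) (Real.sqrt_nonneg _)

theorem solitonSlope_nonpos_of_nonneg (k θ p : ℝ) (hm : 0 < m) {z : ℝ} (hz : 0 ≤ z) :
    solitonSlope k θ p m z ≤ 0 := by
  have htanh : 0 ≤ Real.tanh z := by
    rw [Real.tanh_eq_sinh_div_cosh]
    exact div_nonneg (Real.sinh_nonneg_iff.2 hz) (Real.cosh_pos z).le
  exact div_nonpos_of_nonpos_of_nonneg (mul_nonpos_of_nonpos_of_nonneg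
    (neg_nonpos.2 (Real.sqrt_nonneg _)) (mul_nonneg (semilinearProfile_pos p hm z).le htanh))
    (Real.sqrt_nonneg _)

namespace IsSolitonPhase

variable {z : ℝ → ℝ}

theorem continuous (h : IsSolitonPhase k θ p m z) : Continuous z :=
  continuous_iff_continuousAt.2 fun x => (h.hasDerivAt x).continuousAt

theorem monotone (h : IsSolitonPhase k θ p m z) (hp : 2 < p) : Monotone z :=
  monotone_of_hasDerivAt_nonneg h.hasDerivAt fun x => by
    have : 0 < p - 2 := by linarith
    simp only [Pi.zero_apply]
    positivity

theorem hasDerivAt_profile (h : IsSolitonPhase k θ p m z) (hp : 2 < p) (x : ℝ) :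
    HasDerivAt (fun x => semilinearProfile p m (z x)) (solitonSlope k θ p m (z x)) x := by
  refine ((hasDerivAt_semilinearProfile p m (z x)).comp x (h.hasDerivAt x)).congr_deriv ?_
  have : p - 2 ≠ 0 := by linarith
  rw [solitonSlope]
  field_simp

theorem hasDerivAt_sqrt (h : IsSolitonPhase k θ p m z) (hk : 0 ≤ k) (hp : 2 < p) (x : ℝ) :
    HasDerivAt (fun x => √(1 + 2 * k * semilinearProfile p m (z x) ^ 2))
      (2 * k * semilinearProfile p m (z x) * solitonSlope k θ p m (z x)
        / √(1 + 2 * k * semilinearProfile p m (z x) ^ 2)) x := by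
  have hsq := (((h.hasDerivAt_profile hp x).pow 2).const_mul (2 * k)).const_add 1
  refine (hsq.sqrt ?_).congr_deriv ?_ <;> simp only [Pi.pow_apply]
  · positivity
  · push_cast
    field_simp

theorem hasDerivAt_flux (h : IsSolitonPhase k θ p m z) (hk : 0 ≤ k) (hθ : 0 < θ) (hp : 2 < p)
    (hm : 0 < m) (x : ℝ) :
    HasDerivAt (fun x => (1 + 2 * k * semilinearProfile p m (z x) ^ 2) * solitonSlope k θ p m (z x))
      ((2 * k * solitonSlope k θ p m (z x) ^ 2 + powerFreq θ p m
        - p / 2 * powerFreq θ p (semilinearProfile p m (z x) ^ 2)) * semilinearProfile p m (z x))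
      x := by
  set y := fun x => semilinearProfile p m (z x)
  set d := fun x => √(1 + 2 * k * y x ^ 2)
  set t := fun x => Real.tanh (z x)
  set u' := fun x => solitonSlope k θ p m (z x)
  have hd0 : d x ≠ 0 := (zero_lt_one.trans_le (one_le_sqrt_one_add hk (y x))).ne'
  have hslope : ∀ x, d x * u' x = -√(powerFreq θ p m) * (y x * t x) :=
    fun x => sqrt_mul_solitonSlope hk θ p m (z x)
  have hflux : (fun x => (1 + 2 * k * y x ^ 2) * u' x)
      = fun x => d x * (-√(powerFreq θ p m) * (y x * t x)) := by
    funext x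
    rw [← hslope, ← mul_assoc, ← sq, Real.sq_sqrt (by positivity)]
  have hν : √(powerFreq θ p m) ^ 2 = powerFreq θ p m :=
    Real.sq_sqrt (powerFreq_pos hθ (by linarith) hm).le
  have hderiv := (h.hasDerivAt_sqrt hk hp x).mul (((h.hasDerivAt_profile hp x).mul
    ((hasDerivAt_tanh (z x)).comp x (h.hasDerivAt x))).const_mul (-√(powerFreq θ p m)))
  rw [hflux]
  refine hderiv.congr_deriv ?_
  rw [powerFreq_semilinearProfile_sq θ hp hm.le]
  change 2 * k * y x * u' x / d x * (-√(powerFreq θ p m) * (y x * t x))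
    + d x * (-√(powerFreq θ p m) * (u' x * t x
      + y x * ((1 - t x ^ 2) * ((p - 2) / 2 * √(powerFreq θ p m) / d x))))
    = (2 * k * u' x ^ 2 + powerFreq θ p m - p / 2 * (powerFreq θ p m * (1 - t x ^ 2))) * y x
  rw [← hslope x]
  field_simp
  linear_combination (-(p - 2) * y x * (1 - t x ^ 2) + 2 * y x * t x ^ 2) * hν
    - 2 * √(powerFreq θ p m) * t x * hslope x

theorem integrable_profile_sq (h : IsSolitonPhase k θ p m z) (hk : 0 ≤ k) (hθ : 0 < θ)
    (hp : 2 < p) (hm : 0 < m) : Integrable fun x => semilinearProfile p m (z x) ^ 2 := by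
  have hspeed : 0 < (p - 2) / 2 * √(powerFreq θ p m) :=
    mul_pos (by linarith) (Real.sqrt_pos.2 (powerFreq_pos hθ (by linarith) hm))
  set c := (p - 2) / 2 * √(powerFreq θ p m) / √(1 + 2 * k * m) with hc
  have hc0 : 0 < c := by positivity
  have hr : 0 < 4 / (p - 2) := div_pos (by norm_num) (by linarith)
  have hgrowth : ∀ x, c * |x| ≤ |z x| :=
    mul_abs_le_abs_of_le_deriv h.hasDerivAt h.apply_zero fun x => by
      have := semilinearProfile_sq_le hp hm.le (z x)
      rw [hc]
      gcongr
  refine ((integrable_exp_neg_mul_abs (mul_pos hr hc0)).const_mul (2 ^ (4 / (p - 2)) * m)).mono'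
    (((continuous_semilinearProfile p m).comp h.continuous).pow 2).aestronglyMeasurable
    (ae_of_all _ fun x => ?_)
  rw [Real.norm_of_nonneg (sq_nonneg _), mul_assoc (4 / (p - 2))]
  refine (semilinearProfile_sq_le_exp hp hm.le (z x)).trans ?_
  gcongr
  exact hgrowth x

theorem isSoliton (h : IsSolitonPhase k θ p m z) (hk : 0 ≤ k) (hθ : 0 < θ) (hp : 2 < p)
    (hm : 0 < m) :
    IsSoliton k θ p m (fun x => semilinearProfile p m (z x))
      fun x => solitonSlope k θ p m (z x) where
  hasDerivAt := h.hasDerivAt_profile hp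
  continuous_deriv := (continuous_solitonSlope hk θ p m).comp h.continuous
  pos x := semilinearProfile_pos p hm (z x)
  sq_le x := semilinearProfile_sq_le hp hm.le (z x)
  apply_zero := by rw [h.apply_zero, semilinearProfile_sq p hm.le, Real.cosh_zero, Real.one_rpow,
    one_mul]
  deriv_nonneg x hx := solitonSlope_nonneg_of_nonpos k θ p hm (h.apply_zero ▸ h.monotone hp hx)
  deriv_nonpos x hx := solitonSlope_nonpos_of_nonneg k θ p hm (h.apply_zero ▸ h.monotone hp hx)
  first_integral x := by
    rw [mul_solitonSlope_sq hk hθ hp hm, powerFreq_semilinearProfile_sq θ hp hm.le]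
    ring
  equation := h.hasDerivAt_flux hk hθ hp hm
  integrable_sq := h.integrable_profile_sq hk hθ hp hm

end IsSolitonPhase

theorem exists_isSoliton (hk : 0 ≤ k) (hθ : 0 < θ) (hp : 2 < p) (hm : 0 < m) :
    ∃ u u', IsSoliton k θ p m u u' :=
  let ⟨_, hz⟩ := exists_isSolitonPhase hk hθ hp hm
  ⟨_, _, hz.isSoliton hk hθ hp hm⟩

end Soliton

namespace IsSoliton

variable {k θ p m : ℝ} {u u' : ℝ → ℝ}

theorem locAC (h : IsSoliton k θ p m u u') : LocAC u u' :=
  LocAC.of_hasDerivAt h.hasDerivAt h.continuous_deriv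

theorem deriv_sq_le (h : IsSoliton k θ p m u u') (hk : 0 ≤ k) (hθ : 0 ≤ θ) (hp : 0 ≤ p) (x : ℝ) :
    u' x ^ 2 ≤ powerFreq θ p m * u x ^ 2 := by
  have hν : 0 ≤ powerFreq θ p (u x ^ 2) := by
    unfold powerFreq
    positivity
  calc u' x ^ 2 ≤ (1 + 2 * k * u x ^ 2) * u' x ^ 2 :=
        le_mul_of_one_le_left (sq_nonneg _) (le_add_of_nonneg_right (by positivity))
    _ = u x ^ 2 * (powerFreq θ p m - powerFreq θ p (u x ^ 2)) := h.first_integral x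
    _ ≤ powerFreq θ p m * u x ^ 2 := by linarith [mul_nonneg (sq_nonneg (u x)) hν]

theorem memLp (h : IsSoliton k θ p m u u') : MemLp u 2 :=
  (memLp_two_iff_integrable_sq h.locAC.continuous.aestronglyMeasurable).2 h.integrable_sq

theorem memLp_deriv (h : IsSoliton k θ p m u u') (hk : 0 ≤ k) (hθ : 0 ≤ θ) (hp : 0 ≤ p) :
    MemLp u' 2 := by
  refine (memLp_two_iff_integrable_sq h.continuous_deriv.aestronglyMeasurable).2
    ((h.integrable_sq.const_mul (powerFreq θ p m)).mono'
      (h.continuous_deriv.pow 2).aestronglyMeasurable (ae_of_all _ fun x => ?_))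
  rw [Real.norm_of_nonneg (sq_nonneg _)]
  exact h.deriv_sq_le hk hθ hp x

theorem memLp_comp_mul (h : IsSoliton k θ p m u u') (hk : 0 ≤ k) (hθ : 0 ≤ θ) (hp : 0 ≤ p)
    {Q : ℝ × ℝ → ℝ} (hQ : Continuous Q) {f : ℝ → ℝ} (hf : MemLp f 2) :
    MemLp (fun x => Q (u x, u' x) * f x) 2 := by
  have hm : 0 ≤ m := h.apply_zero ▸ sq_nonneg (u 0)
  have hν : 0 ≤ powerFreq θ p m := by
    unfold powerFreq
    positivity
  let K : Set (ℝ × ℝ) := Icc (-√m) (√m) ×ˢ Icc (-√(powerFreq θ p m * m)) (√(powerFreq θ p m * m))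
  have hK : ∀ x, (u x, u' x) ∈ K := fun x =>
    ⟨abs_le.1 (Real.abs_le_sqrt (h.sq_le x)), abs_le.1 (Real.abs_le_sqrt
      ((h.deriv_sq_le hk hθ hp x).trans (mul_le_mul_of_nonneg_left (h.sq_le x) hν)))⟩
  obtain ⟨C, hC⟩ := (isCompact_Icc.prod isCompact_Icc : IsCompact K).exists_bound_of_continuousOn
    hQ.continuousOn
  exact hf.mul (memLp_top_of_bound
    (hQ.comp (h.locAC.continuous.prodMk h.continuous_deriv)).aestronglyMeasurable C
    (ae_of_all _ fun x => hC _ (hK x)))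

theorem integral_equation (h : IsSoliton k θ p m u u') (hk : 0 ≤ k) (hθ : 0 ≤ θ) (hp : 2 ≤ p)
    {v v' : ℝ → ℝ} (hv : LocAC v v') (hvLp : MemLp v 2) (hvLp' : MemLp v' 2) :
    (∫ x, u' x * v' x) + powerFreq θ p m * (∫ x, u x * v x)
      + k * (∫ x, 2 * u x * u' x * (u' x * v x + u x * v' x))
      - p / 2 * (∫ x, powerFreq θ p (u x ^ 2) * u x * v x) = 0 := by
  have hp0 : 0 ≤ p := by linarith
  have hcont := h.locAC.continuous
  have hcont' := h.continuous_deriv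
  have hν := continuous_powerFreq θ hp
  have hu := h.memLp
  have hu' := h.memLp_deriv hk hθ hp0
  have hmul {Q : ℝ × ℝ → ℝ} (hQ : Continuous Q) {f : ℝ → ℝ} (hf : MemLp f 2) :=
    h.memLp_comp_mul hk hθ hp0 hQ hf
  have hflux : MemLp (fun x => (1 + 2 * k * u x ^ 2) * u' x) 2 :=
    hmul (Q := fun z => 1 + 2 * k * z.1 ^ 2) (by fun_prop) hu'
  have hsource : MemLp (fun x => (2 * k * u' x ^ 2 + powerFreq θ p m
      - p / 2 * powerFreq θ p (u x ^ 2)) * u x) 2 :=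
    hmul (Q := fun z => 2 * k * z.2 ^ 2 + powerFreq θ p m - p / 2 * powerFreq θ p (z.1 ^ 2))
      (by fun_prop) hu
  have hparts := (LocAC.of_hasDerivAt h.equation (by fun_prop)).integral_mul_add_mul_eq_zero hv
    hflux hsource hvLp hvLp'
  have hi₁ : Integrable fun x => u' x * v' x := hu'.integrable_mul hvLp'
  have hi₂ : Integrable fun x => u x * v x := hu.integrable_mul hvLp
  have hi₃ : Integrable fun x => 2 * u x * u' x * (u' x * v x + u x * v' x) :=
    (hmul (Q := fun z => 2 * z.1) (by fun_prop) hu').integrable_mul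
      ((hmul continuous_snd hvLp).add (hmul continuous_fst hvLp'))
  have hi₄ : Integrable fun x => powerFreq θ p (u x ^ 2) * u x * v x :=
    (hmul (Q := fun z => powerFreq θ p (z.1 ^ 2)) (by fun_prop) hu).integrable_mul hvLp
  have hi₁₂ : Integrable fun x => u' x * v' x + powerFreq θ p m * (u x * v x) :=
    hi₁.add (hi₂.const_mul _)
  have hi₁₂₃ : Integrable fun x => u' x * v' x + powerFreq θ p m * (u x * v x)
      + k * (2 * u x * u' x * (u' x * v x + u x * v' x)) := hi₁₂.add (hi₃.const_mul _)
  rw [← hparts, ← integral_const_mul, ← integral_const_mul, ← integral_const_mul,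
    ← integral_add hi₁ (hi₂.const_mul _), ← integral_add hi₁₂ (hi₃.const_mul k),
    ← integral_sub hi₁₂₃ (hi₄.const_mul _)]
  refine integral_congr_ae (ae_of_all _ fun x => ?_)
  ring

theorem isPositiveSolution (h : IsSoliton k θ p m u u') (hk : 0 ≤ k) (hθ : 0 ≤ θ) (hp : 2 ≤ p) :
    IsPositiveSolution k θ (powerFreq θ p m) p u := by
  have hp0 : 0 < p := by linarith
  refine ⟨h.locAC.continuous, h.pos, h.locAC.memH1 h.memLp (h.memLp_deriv hk hθ hp0.le),
    fun f hf => ?_⟩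
  obtain ⟨v, v', hv, hfv, hvLp, hvLp'⟩ := hf.exists_locAC
  have hkinetic : ∫ x, weakDeriv u x * weakDeriv f x = ∫ x, u' x * v' x :=
    integral_congr_ae ((h.locAC.weakDeriv_ae_eq .rfl).fun_mul (hv.weakDeriv_ae_eq hfv))
  have hmass : ∫ x, u x * f x = ∫ x, u x * v x :=
    integral_congr_ae ((EventuallyEq.refl _ u).fun_mul hfv)
  have hquasi : ∫ x, weakDeriv (fun y => u y ^ 2) x * weakDeriv (fun y => u y * f y) x
      = ∫ x, 2 * u x * u' x * (u' x * v x + u x * v' x) :=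
    integral_congr_ae ((h.locAC.sq.weakDeriv_ae_eq .rfl).fun_mul
      ((h.locAC.mul hv).weakDeriv_ae_eq ((EventuallyEq.refl _ u).fun_mul hfv)))
  have hpower : θ * ∫ x, |u x| ^ (p - 2) * u x * f x
      = p / 2 * ∫ x, powerFreq θ p (u x ^ 2) * u x * v x := by
    rw [← integral_const_mul, ← integral_const_mul]
    refine integral_congr_ae (hfv.mono fun x hx => ?_)
    simp only [hx]
    linear_combination -(u x * v x) * half_mul_powerFreq_sq θ hp0.ne' (u x)
  rw [hkinetic, hmass, hquasi, hpower, h.integral_equation hk hθ hp hv hvLp hvLp']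

theorem nehari (h : IsSoliton k θ p m u u') (hk : 0 ≤ k) (hθ : 0 ≤ θ) (hp : 2 ≤ p) :
    (∫ x, u' x ^ 2) + powerFreq θ p m * (∫ x, u x ^ 2) + k * (∫ x, (2 * u x * u' x) ^ 2)
      - p / 2 * (∫ x, powerFreq θ p (u x ^ 2) * u x ^ 2) = 0 := by
  have hquasi : ∀ x, 2 * u x * u' x * (u' x * u x + u x * u' x) = (2 * u x * u' x) ^ 2 :=
    fun x => by ring
  simpa only [hquasi, mul_assoc (powerFreq _ _ _), ← sq] using
    h.integral_equation hk hθ hp h.locAC h.memLp (h.memLp_deriv hk hθ (by linarith))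

theorem isMadelungTriple (h : IsSoliton k θ p m u u') (hk : 0 ≤ k) (hθ : 0 ≤ θ) (hp : 0 ≤ p) :
    IsMadelungTriple (fun x => u x ^ 2) (fun x => 2 * u x * u' x) fun x => u' x ^ 2 where
  locAC := h.locAC.sq
  nonneg _ := sq_nonneg _
  kinetic_nonneg _ := sq_nonneg _
  integrable := h.integrable_sq
  integrable_kinetic := (h.memLp_deriv hk hθ hp).integrable_sq
  sq_deriv_le _ := by ring_nf; rfl

theorem action_eq (h : IsSoliton k θ p m u u') (hk : 0 ≤ k) (hθ : 0 ≤ θ) (hp : 2 ≤ p) :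
    action k (powerFreq θ p) m
      = madelungEnergy k (powerFreq θ p) (fun x => u x ^ 2) (fun x => 2 * u x * u' x)
          (fun x => u' x ^ 2) + powerFreq θ p m * (1 / 2 * ∫ x, u x ^ 2) := by
  have hpos := h.pos
  have htriple := h.isMadelungTriple hk hθ (by linarith)
  simpa only [h.apply_zero] using htriple.action_eq (x₀ := 0) hk (continuous_powerFreq θ hp)
    (fun x => by ring) (fun x => by rw [h.first_integral, h.apply_zero])
    (fun x hx => mul_nonneg (by linarith [hpos x]) (h.deriv_nonneg x hx))
    fun x hx => mul_nonpos_of_nonneg_of_nonpos (by linarith [hpos x]) (h.deriv_nonpos x hx)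

theorem mass_eq (h : IsSoliton k θ p m u u') (hk : 0 ≤ k) (hθ : 0 < θ) (hp : 2 < p) {lam : ℝ}
    (hmin : IsMinOn (reducedEnergy k (powerFreq θ p) lam) (Ioi 0) m) :
    1 / 2 * ∫ x, u x ^ 2 = lam := by
  have hm : 0 < m := h.apply_zero ▸ sq_pos_of_pos (h.pos 0)
  have htriple := h.isMadelungTriple hk hθ.le (by linarith)
  refine htriple.mass_eq_of_isMinOn (x₀ := 0) hk hθ hp ?_ ?_ ?_ ?_ ?_ <;>
    simp only [h.apply_zero]
  exacts [h.sq_le, hm, h.action_eq hk hθ.le hp.le, h.nehari hk hθ.le hp.le, hmin]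

theorem hasWeakDeriv_ofReal (h : IsSoliton k θ p m u u') :
    HasWeakDeriv (fun x => (u x : ℂ)) fun x => (u' x : ℂ) :=
  h.locAC.hasWeakDeriv.clm_comp Complex.ofRealCLM

theorem mem_massSphere (h : IsSoliton k θ p m u u') (hk : 0 ≤ k) (hθ : 0 ≤ θ) (hp : 0 ≤ p) :
    (fun x => (u x : ℂ)) ∈ massSphere (1 / 2 * ∫ x, u x ^ 2) := by
  refine ⟨⟨h.memLp.ofReal, _, h.hasWeakDeriv_ofReal, (h.memLp_deriv hk hθ hp).ofReal⟩, ?_⟩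
  simp only [Complex.norm_real, Real.norm_eq_abs, sq_abs]

theorem energy_eq (h : IsSoliton k θ p m u u') (hk : 0 ≤ k) (hθ : 0 ≤ θ) (hp : 2 ≤ p) :
    energy k θ p (fun x => (u x : ℂ))
      = reducedEnergy k (powerFreq θ p) (1 / 2 * ∫ x, u x ^ 2) m := by
  rw [reducedEnergy, h.action_eq hk hθ hp, add_sub_cancel_right]
  refine energy_eq_madelungEnergy (by linarith) h.locAC.sq (ae_of_all _ fun x => ?_)
    (h.hasWeakDeriv_ofReal.weakDeriv_ae_eq.mono fun x hx => ?_)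
  · rw [Complex.norm_real, Real.norm_eq_abs, sq_abs]
  · rw [hx, Complex.norm_real, Real.norm_eq_abs, sq_abs]

end IsSoliton

theorem exists_isPositiveSolution {k θ p μ : ℝ} (hk : 0 ≤ k) (hθ : 0 < θ) (hp : 2 < p)
    (hμ : 0 < μ) : ∃ u, IsPositiveSolution k θ μ p u := by
  obtain ⟨m, hm, rfl⟩ := exists_powerFreq_eq hθ hp hμ
  obtain ⟨u, u', h⟩ := exists_isSoliton hk hθ hp hm
  exact ⟨u, h.isPositiveSolution hk hθ.le hp.le⟩

theorem exists_reducedEnergy_le_energy {k θ p lam : ℝ} (hk : 0 ≤ k) (hθ : 0 ≤ θ) (hp : 2 ≤ p)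
    (hlam : 0 < lam) {w : ℝ → ℂ} (hw : w ∈ massSphere lam) :
    ∃ m, 0 < m ∧ reducedEnergy k (powerFreq θ p) lam m ≤ energy k θ p w := by
  obtain ⟨ρ, ρ', N, h, hρ, hN⟩ := hw.1.exists_isMadelungTriple
  have hmass : 1 / 2 * ∫ x, ρ x = lam := integral_congr_ae hρ ▸ hw.2
  obtain ⟨x₀, hpos, hmax⟩ := h.exists_forall_le (by linarith)
  have hle := h.reducedEnergy_le hk hθ hp hmax lam
  rw [hmass, sub_self, mul_zero, add_zero] at hle
  exact ⟨ρ x₀, hpos, hle.trans_eq (energy_eq_madelungEnergy (by linarith) h.locAC hρ hN).symm⟩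

theorem IsSoliton.isMinOn_energy {k θ p m lam : ℝ} {u u' : ℝ → ℝ} (h : IsSoliton k θ p m u u')
    (hk : 0 ≤ k) (hθ : 0 < θ) (hp : 2 < p) (hlam : 0 < lam)
    (hmin : IsMinOn (reducedEnergy k (powerFreq θ p) lam) (Ioi 0) m) :
    IsMinOn (energy k θ p) (massSphere lam) fun x => (u x : ℂ) := fun w hw => by
  obtain ⟨M, hM, hle⟩ := exists_reducedEnergy_le_energy hk hθ.le hp.le hlam hw
  calc energy k θ p (fun x => (u x : ℂ)) = reducedEnergy k (powerFreq θ p) lam m := by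
        rw [h.energy_eq hk hθ.le hp.le, h.mass_eq hk hθ hp hmin]
    _ ≤ reducedEnergy k (powerFreq θ p) lam M := hmin hM
    _ ≤ energy k θ p w := hle

theorem theorem4p6_general {p k : ℝ} (hp2 : 2 < p) (hp6 : p < 6) (hk : 0 ≤ k) :
    (∀ lam : ℝ, 0 < lam → ∀ θ : ℝ, 0 < θ →
      ∃ γ : ℝ, γ < 0 ∧ ∃ u : ℝ → ℝ,
        (fun x => (u x : ℂ)) ∈ massSphere lam ∧
        IsMinOn (energy k θ p) (massSphere lam) (fun x => (u x : ℂ)) ∧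
        IsPositiveSolution k θ (-γ) p u) ∧
    (∀ γ : ℝ, γ < 0 → ∀ θ : ℝ, 0 < θ → ∃ u : ℝ → ℝ, IsPositiveSolution k θ (-γ) p u) := by
  refine ⟨fun lam hlam θ hθ => ?_, fun γ hγ θ hθ =>
    exists_isPositiveSolution hk hθ hp2 (neg_pos.2 hγ)⟩
  obtain ⟨m, hm, hmin⟩ := exists_isMinOn_reducedEnergy hk hθ hp2 hp6 hlam
  obtain ⟨u, u', h⟩ := exists_isSoliton hk hθ hp2 hm
  refine ⟨-powerFreq θ p m, neg_neg_of_pos (powerFreq_pos hθ (by linarith) hm), u, ?_,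
    h.isMinOn_energy hk hθ hp2 hlam hmin, ?_⟩
  · exact h.mass_eq hk hθ hp2 hmin ▸ h.mem_massSphere hk hθ.le (by linarith)
  · rw [neg_neg]
    exact h.isPositiveSolution hk hθ.le hp2.le

theorem theorem4p6 (p k : ℝ) (hp4 : 4 ≤ p) (hp6 : p < 6) (hk : 0 ≤ k) :
    (∀ lam : ℝ, 0 < lam → ∀ θ : ℝ, 0 < θ →
      ∃ γ : ℝ, γ < 0 ∧ ∃ u : ℝ → ℝ,
        (fun x => (u x : ℂ)) ∈ massSphere lam ∧
        IsMinOn (energy k θ p) (massSphere lam) (fun x => (u x : ℂ)) ∧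
        IsPositiveSolution k θ (-γ) p u) ∧
    (∃ γ : ℝ, γ < 0 ∧ ∀ θ : ℝ, 0 < θ → ∃ u : ℝ → ℝ, IsPositiveSolution k θ (-γ) p u) :=
  have h := theorem4p6_general (by linarith) hp6 hk
  ⟨h.1, -1, by norm_num, h.2 (-1) (by norm_num)⟩
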